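/- **Setting.** Let $n,N\ge 1$. A network of $n$ sensors has local regressors $C_i(t)\in\mathbb R^{N_y\times N}$ and an undirected, time-dependent communication graph $\mathcal G(t)$ on $\{1,\dots,n\}$ with $n_e(t)$ edges, an arbitrarily oriented incidence matrix $D(t)\in\mathbb R^{n\times n_e(t)}$ (in each column $+1$ at the source, $-1$ at the sink, $0$ elsewhere) and Laplacian $L(t)=D(t)D(t)^\top$; all of these depend measurably on $t$. For a consensus gain $\alpha>0$ put $$\bar\Lambda(t)=\begin{bmatrix}\mathrm{diag}(C_1(t),\dots,C_n(t))\\ \sqrt\alpha\,D(t)^\top\otimes I_N\end{bmatrix}.$$ **Assumption.** There are constants $T>0$, $\bar\iota_1\ge\underline\iota_1>0$, $r_2>0$, $r_3>0$, $\underline\lambda>0$ such that for all $t\ge T$ one has $\bar\iota_1I_N\ge\int_{t-T}^t\sum_iC_i(s)^\top C_i(s)\,ds\ge\underline\iota_1I_N$, and $\int_{t-T}^tL(s)\,ds$ has exactly one zero eigenvalue (counted with multiplicity) while all other eigenvalues are $\ge\underline\lambda$; and such that $\|C_i(t)^\top C_i(t)\|\le r_2$ and $\|L(t)\|\le r_3$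 for all $t\ge0$ and all $i$ (induced Euclidean norms). **Excitation bounds.** Let $r_1>0$ be a bound for the norm of the gain matrix $\bar\Gamma$ chosen below ($\|\bar\Gamma\|\le r_1$; for instance $r_1=\|\bar\Gamma\|$). As functions of $\alpha>0$ put $r_4=r_2+\alpha r_3$, $\bar\iota_2=Tr_4$, $$\underline\iota_2=\min_{0\le\rho\le1}\max\Big\{\alpha\underline\lambda(1-\rho^2),\ \tfrac{\underline\iota_1}{n}\rho^2-2r_2T\sqrt{\rho^2(1-\rho^2)}\Big\},$$ $\varphi_1=\tfrac12r_1^2\bar\iota_2^2$, $\varphi_2=\tfrac14(e^{2r_1\bar\iota_2}-1)-\tfrac12r_1\bar\iota_2$, $$\bar\iota_3=\Big(\sqrt{\bar\iota_2-\underline\iota_2+\varphi_2\underline\iota_2}+\sqrt{\bar\iota_2}\Big)^2,\qquad \underline\iota_3=\Big(\frac{\sqrt{\bar\iota_2-\underline\iota_2+\varphi_1\underline\iota_2}-\sqrt{\bar\iota_2}}{\varphi_1-1}\Big)^2\ \text{ if }\varphi_1\ne1,\qquad \underline\iota_3=\frac{\underline\iota_2^2}{4\bar\iota_2}\ \text{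 if }\varphi_1=1 .$$ **Disturbed error system.** Let $\Gamma_1,\dots,\Gamma_n\in\mathbb R^{N\times N}$ be symmetric positive definite, $\bar\Gamma=\mathrm{diag}(\Gamma_1,\dots,\Gamma_n)$, $\Delta_1\in\mathbb R^{N\times r}$, $\bar\Delta_1=\mathbf 1_n\otimes\Delta_1$, and $\bar\Delta_2(t)\in\mathbb R^{(nN_y+Nn_e(t))\times r}$ measurable in $t$. Let $Q\in\mathbb R^{p\times nN}$, $W\in\mathbb R^{p\times r}$ with $W^\top W=I_r$, $Q^\top W=0$. Consider, for $t\ge 0$, $$\dot{\tilde x}=-\bar\Gamma\bar\Lambda^\top\bar\Lambda\,\tilde x+(\bar\Gamma\bar\Lambda^\top\bar\Delta_2-\bar\Delta_1)\delta,\qquad z=Q\tilde x+W\delta .$$ **Statement.** Choose $\alpha>0$ as a maximizer of $\underline\iota_3(\alpha)/\bar\iota_3(\alpha)$ over $\alpha\in\mathbb R_{>0}$, and choose $c_2>0$ with $$\begin{bmatrix}\frac{c_2\underline\iota_3}{2}I_{nN}&-Q^\top\\-Q&I_p\end{bmatrix}>0 .$$ Consider the semidefinite program in the scalar variables $(c_1,\gamma_1,\gamma_2,\gamma)$: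 minimize $\gamma$ subject to $\gamma>0$, $\gamma_1-\gamma_2\ge0$ and, for all $t\ge 0$, $$\begin{bmatrix}\Phi_{11}&\Phi_{12}\\\Phi_{12}^\top&-\gamma_2I_{nN}\end{bmatrix}\le0,\qquad \Phi_{11}=\begin{bmatrix}(-c_1+c_2T)I&0&0&0\\0&-\frac{c_2\underline\iota_3}2I_{nN}&Q^\top&0\\0&Q&-I_p&W\\0&0&W^\top&\phi_{44}\end{bmatrix},\qquad \Phi_{12}=\begin{bmatrix}0\\0\\0\\-\frac{2c_1}{\sqrt{c_2\underline\iota_3}}\bar\Delta_1^\top\end{bmatrix},$$ $$\phi_{44}=\frac{8c_2\bar\iota_3^2}{\underline\iota_3}\bar\Delta_1^\top\bar\Delta_1+\Big(c_1+\frac{8c_2\bar\iota_3^2r_4\gamma_1}{\underline\iota_3}\Big)\bar\Delta_2(t)^\top\bar\Delta_2(t)-\gamma I_r,$$ where the first identity block has size $nN_y+Nn_e(t)$. If $(c_1,\gamma_1,\gamma_2,\gamma)$ is any feasible point of this program (in particular, if it is a minimizer) and $\bar\Gamma$ is chosen, with $\|\bar\Gamma\|\le r_1$, such that $\sqrt{\gamma_1}\,I_{nN}\ge\bar\Gamma\ge\sqrt{\gamma_2}\,I_{nN}$,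 then for every initial state $\tilde x(0)$ the system from $\delta$ to $z$ has an $\mathcal L_2$-gain of at most $\sqrt\gamma$. Here the $\mathcal L_2$-gain is the infimum of all $g\ge0$ for which there is a $b\ge0$ such that, for every $\delta\in\mathcal L_2([0,\infty))$, one has $z\in\mathcal L_2([0,\infty))$ and $\|z\|_{\mathcal L_2}\le g\|\delta\|_{\mathcal L_2}+b$. -/

import Mathlib

open MeasureTheory Matrix
open scoped ENNReal NNReal Kronecker Matrix.Norms.L2Operator

noncomputable section

namespace CIEstimation

/-! ### Graphs and stacked matrices -/

/-- An orientation of a simple graph: each undirected edge is kept as exactly one of its two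
ordered pairs (source, sink). -/
structure Orientation {n : ℕ} (G : SimpleGraph (Fin n)) where
  /-- the oriented edges, as pairs (source, sink) -/
  edges : Finset (Fin n × Fin n)
  adj_iff : ∀ i j, G.Adj i j ↔ ((i, j) ∈ edges ∨ (j, i) ∈ edges)
  asymm : ∀ i j, (i, j) ∈ edges → (j, i) ∉ edges

/-- The oriented incidence matrix, one column for each edge: entry `1` at the source, `-1` at the
sink, `0` elsewhere. -/
def incidence {n : ℕ} {G : SimpleGraph (Fin n)} (o : Orientation G) :
    Matrix (Fin n) o.edges ℝ :=
  Matrix.of fun i e => if i = e.1.1 then 1 else if i = e.1.2 then -1 else 0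

/-- The graph Laplacian `L = D Dᵀ`. -/
def laplacian {n : ℕ} {G : SimpleGraph (Fin n)} (o : Orientation G) :
    Matrix (Fin n) (Fin n) ℝ :=
  incidence o * (incidence o)ᵀ

/-- `diag(A₁, …, Aₙ)` for rectangular blocks. -/
def blkDiag {n a b : ℕ} (A : Fin n → Matrix (Fin a) (Fin b) ℝ) :
    Matrix (Fin n × Fin a) (Fin n × Fin b) ℝ :=
  Matrix.of fun i j => if i.1 = j.1 then A i.1 i.2 j.2 else 0

/-- `1ₙ ⊗ A`: the matrix `A` stacked `n` times. -/
def stackOnes {N r : ℕ} (n : ℕ) (A : Matrix (Fin N) (Fin r) ℝ) :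
    Matrix (Fin n × Fin N) (Fin r) ℝ :=
  Matrix.of fun i j => A i.2 j

/-- Entrywise integral `∫ₐᵇ A(s) ds` of a matrix-valued function. -/
def matIntegral {k l : Type*} (A : ℝ → Matrix k l ℝ) (a b : ℝ) : Matrix k l ℝ :=
  Matrix.of fun i j => ∫ s in a..b, A s i j

/-! ### The sensor network -/

/-- A network of `n` sensors with local regressors `Cᵢ(t)` (`Ny × N`) and an undirected,
time-dependent communication graph `G(t)` with an arbitrary orientation at every time.
The time dependence is measurable. -/
structure SensorNetwork (n Ny N : ℕ) where
  C : Fin n → ℝ → Matrix (Fin Ny) (Fin N) ℝ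
  G : ℝ → SimpleGraph (Fin n)
  orient : ∀ t, Orientation (G t)
  measurable_C : ∀ i k l, Measurable fun t => C i t k l
  measurableSet_edge : ∀ i j, MeasurableSet {t | (i, j) ∈ (orient t).edges}

namespace SensorNetwork

variable {n Ny N : ℕ}

/-- The Laplacian `L(t)`. -/
def L (S : SensorNetwork n Ny N) (t : ℝ) : Matrix (Fin n) (Fin n) ℝ := laplacian (S.orient t)

/-- Index set of the stacked output at time `t`: the `n Ny` measurements, followed by the
`N nₑ(t)` differences of the estimates across the edges present at time `t`. -/
abbrev OutIdx (S : SensorNetwork n Ny N) (t : ℝ) : Type :=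
  (Fin n × Fin Ny) ⊕ ((S.orient t).edges × Fin N)

/-- `Λ̄(t)`: the rows `diag(C₁(t), …, Cₙ(t))` above the rows `√α Dᵀ(t) ⊗ I_N`. -/
def Lam (S : SensorNetwork n Ny N) (α t : ℝ) : Matrix (S.OutIdx t) (Fin n × Fin N) ℝ :=
  Matrix.fromRows (blkDiag fun i => S.C i t)
    (√α • ((incidence (S.orient t))ᵀ ⊗ₖ (1 : Matrix (Fin N) (Fin N) ℝ)))

theorem L_isHermitian (S : SensorNetwork n Ny N) (t : ℝ) : (S.L t).IsHermitian := by
  rw [Matrix.IsHermitian, conjTranspose_eq_transpose_of_trivial]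
  simp [L, laplacian, Matrix.transpose_mul]

theorem matIntegral_L_isHermitian (S : SensorNetwork n Ny N) (a b : ℝ) :
    (matIntegral S.L a b).IsHermitian := by
  ext i j
  have h : ∀ t, S.L t j i = S.L t i j := fun t => by simpa using (S.L_isHermitian t).apply i j
  simp [matIntegral, h]

/-- A family of disturbance matrices `Δ̄₂(t)`, with as many rows as the output at time `t`. -/
abbrev OutDisturbance (S : SensorNetwork n Ny N) (r : ℕ) : Type :=
  ∀ t, Matrix (S.OutIdx t) (Fin r) ℝ

/-- All entries of `Δ̄₂` depend measurably on time (the entries belonging to an edge being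
extended by zero to the times at which the edge is absent). -/
structure OutDisturbance.IsMeasurable {S : SensorNetwork n Ny N} {r : ℕ}
    (Δ₂ : S.OutDisturbance r) : Prop where
  meas : ∀ (k : Fin n × Fin Ny) (j : Fin r), Measurable fun t => Δ₂ t (Sum.inl k) j
  edge : ∀ (e : Fin n × Fin n) (k : Fin N) (j : Fin r), Measurable fun t =>
    open Classical in
    if h : e ∈ (S.orient t).edges then Δ₂ t (Sum.inr (⟨e, h⟩, k)) j else 0

end SensorNetwork

/-! ### Excitation assumption and excitation bounds -/

/-- The real constants of the excitation assumption. -/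
structure Constants where
  /-- window length -/
  T : ℝ
  /-- lower excitation level -/
  ι₁lo : ℝ
  /-- upper excitation level -/
  ι₁hi : ℝ
  /-- bound for the local regressors -/
  r₂ : ℝ
  /-- bound for the Laplacian -/
  r₃ : ℝ
  /-- lower bound for the nonzero eigenvalues of the integrated Laplacian -/
  lam : ℝ

/-- Cooperative persistence of excitation, uniformly bounded regressors, and a communication
graph that is connected on average with uniformly bounded Laplacian. -/
structure Excitation {n Ny N : ℕ} (S : SensorNetwork n Ny N) (K : Constants) : Prop where
  T_pos : 0 < K.T
  ι₁lo_pos : 0 < K.ι₁lo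
  ι₁lo_le : K.ι₁lo ≤ K.ι₁hi
  r₂_pos : 0 < K.r₂
  r₃_pos : 0 < K.r₃
  lam_pos : 0 < K.lam
  cpe_upper : ∀ t, K.T ≤ t →
    (K.ι₁hi • (1 : Matrix (Fin N) (Fin N) ℝ)
      - matIntegral (fun s => ∑ i, (S.C i s)ᵀ * S.C i s) (t - K.T) t).PosSemidef
  cpe_lower : ∀ t, K.T ≤ t →
    (matIntegral (fun s => ∑ i, (S.C i s)ᵀ * S.C i s) (t - K.T) t
      - K.ι₁lo • (1 : Matrix (Fin N) (Fin N) ℝ)).PosSemidef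
  regressor_le : ∀ i t, 0 ≤ t → ‖(S.C i t)ᵀ * S.C i t‖ ≤ K.r₂
  connected : ∀ t, K.T ≤ t → ∃ i₀,
    (S.matIntegral_L_isHermitian (t - K.T) t).eigenvalues i₀ = 0 ∧
    ∀ i, i ≠ i₀ → K.lam ≤ (S.matIntegral_L_isHermitian (t - K.T) t).eigenvalues i
  laplacian_le : ∀ t, 0 ≤ t → ‖S.L t‖ ≤ K.r₃

namespace Constants

/-- `r₄ = r₂ + α r₃`. -/
def r₄ (K : Constants) (α : ℝ) : ℝ := K.r₂ + α * K.r₃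

/-- `ῑ₂ = T r₄`. -/
def ι₂hi (K : Constants) (α : ℝ) : ℝ := K.T * K.r₄ α

/-- The lower bound of the Gramian under zero dynamics: the minimum over `0 ≤ ρ ≤ 1`
(`ρ` is the norm of the vector `a`, on which alone the expression depends) of
`max {α λ (1 - ρ²), (ι₁/n) ρ² - 2 r₂ T √(ρ² (1 - ρ²))}`. -/
def ι₂lo (n : ℕ) (K : Constants) (α : ℝ) : ℝ :=
  sInf ((fun ρ : ℝ => max (α * K.lam * (1 - ρ ^ 2))
    (K.ι₁lo / n * ρ ^ 2 - 2 * K.r₂ * K.T * √(ρ ^ 2 * (1 - ρ ^ 2)))) '' Set.Icc 0 1)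

/-- `φ₁ = r₁² ῑ₂² / 2`. -/
def φ₁ (K : Constants) (r₁ α : ℝ) : ℝ := 1 / 2 * r₁ ^ 2 * K.ι₂hi α ^ 2

/-- `φ₂ = (e^{2 r₁ ῑ₂} - 1) / 4 - r₁ ῑ₂ / 2`. -/
def φ₂ (K : Constants) (r₁ α : ℝ) : ℝ :=
  1 / 4 * (Real.exp (2 * r₁ * K.ι₂hi α) - 1) - 1 / 2 * r₁ * K.ι₂hi α

/-- The upper excitation bound `ῑ₃`. -/
def ι₃hi (n : ℕ) (K : Constants) (r₁ α : ℝ) : ℝ :=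
  (√(K.ι₂hi α - K.ι₂lo n α + K.φ₂ r₁ α * K.ι₂lo n α) + √(K.ι₂hi α)) ^ 2

open Classical in
/-- The lower excitation bound `ι₃`; its value for `φ₁ = 1` is the limit of the other case. -/
def ι₃lo (n : ℕ) (K : Constants) (r₁ α : ℝ) : ℝ :=
  if K.φ₁ r₁ α = 1 then K.ι₂lo n α ^ 2 / (4 * K.ι₂hi α)
  else ((√(K.ι₂hi α - K.ι₂lo n α + K.φ₁ r₁ α * K.ι₂lo n α) - √(K.ι₂hi α))
    / (K.φ₁ r₁ α - 1)) ^ 2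

end Constants

/-! ### Disturbed error dynamics and `L₂`-gain -/

/-- Lebesgue measure on the half line `[0, ∞)`. -/
abbrev halfLine : Measure ℝ := volume.restrict (Set.Ici 0)

/-- Right-hand side of the disturbed error dynamics,
`-Γ̄ Λ̄ᵀ Λ̄ x + (Γ̄ Λ̄ᵀ Δ̄₂ - Δ̄₁) δ`. -/
def errRhs {n Ny N r : ℕ} (S : SensorNetwork n Ny N) (α : ℝ)
    (Γ : Fin n → Matrix (Fin N) (Fin N) ℝ) (Δ₁ : Matrix (Fin N) (Fin r) ℝ)
    (Δ₂ : S.OutDisturbance r) (t : ℝ) (x : EuclideanSpace ℝ (Fin n × Fin N))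
    (δ : EuclideanSpace ℝ (Fin r)) : EuclideanSpace ℝ (Fin n × Fin N) :=
  -Matrix.toEuclideanLin (blkDiag Γ * (S.Lam α t)ᵀ * S.Lam α t) x
    + Matrix.toEuclideanLin (blkDiag Γ * (S.Lam α t)ᵀ * Δ₂ t - stackOnes n Δ₁) δ

/-- `x` is the (Carathéodory) trajectory on `[0, ∞)` of the disturbed error dynamics with
disturbance `δ` and initial value `x₀`. -/
def IsTrajectory {n Ny N r : ℕ} (S : SensorNetwork n Ny N) (α : ℝ)
    (Γ : Fin n → Matrix (Fin N) (Fin N) ℝ) (Δ₁ : Matrix (Fin N) (Fin r) ℝ)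
    (Δ₂ : S.OutDisturbance r) (x₀ : EuclideanSpace ℝ (Fin n × Fin N))
    (δ : ℝ → EuclideanSpace ℝ (Fin r)) (x : ℝ → EuclideanSpace ℝ (Fin n × Fin N)) : Prop :=
  ∀ t, 0 ≤ t →
    IntervalIntegrable (fun s => errRhs S α Γ Δ₁ Δ₂ s (x s) (δ s)) volume 0 t ∧
    x t = x₀ + ∫ s in (0 : ℝ)..t, errRhs S α Γ Δ₁ Δ₂ s (x s) (δ s)

/-- The system from the disturbance `δ` to the performance output `z = Q x + W δ`, started
at `x₀`, as an input-output relation. -/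
def IORelation {n Ny N r p : ℕ} (S : SensorNetwork n Ny N) (α : ℝ)
    (Γ : Fin n → Matrix (Fin N) (Fin N) ℝ) (Δ₁ : Matrix (Fin N) (Fin r) ℝ)
    (Δ₂ : S.OutDisturbance r) (Q : Matrix (Fin p) (Fin n × Fin N) ℝ)
    (W : Matrix (Fin p) (Fin r) ℝ) (x₀ : EuclideanSpace ℝ (Fin n × Fin N))
    (δ : ℝ → EuclideanSpace ℝ (Fin r)) (z : ℝ → EuclideanSpace ℝ (Fin p)) : Prop :=
  ∃ x, IsTrajectory S α Γ Δ₁ Δ₂ x₀ δ x ∧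
    ∀ t, 0 ≤ t → z t = Matrix.toEuclideanLin Q (x t) + Matrix.toEuclideanLin W (δ t)

/-- The system `H` maps `L₂` inputs to `L₂` outputs and, for some bias `b ≥ 0`,
`‖H u‖ ≤ g ‖u‖ + b` for all `u` in `L₂`. -/
def HasL2Bound {r p : ℕ}
    (H : (ℝ → EuclideanSpace ℝ (Fin r)) → (ℝ → EuclideanSpace ℝ (Fin p)) → Prop)
    (g : ℝ≥0) : Prop :=
  ∃ b : ℝ≥0, ∀ u z, MemLp u 2 halfLine → H u z →
    MemLp z 2 halfLine ∧ eLpNorm z 2 halfLine ≤ g * eLpNorm u 2 halfLine + b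

/-- The `L₂`-gain: the infimum of all admissible `g` (and `∞` if there is none). -/
def l2Gain {r p : ℕ}
    (H : (ℝ → EuclideanSpace ℝ (Fin r)) → (ℝ → EuclideanSpace ℝ (Fin p)) → Prop) : ℝ≥0∞ :=
  ⨅ (g : ℝ≥0) (_ : HasL2Bound H g), (g : ℝ≥0∞)

/-! ### The tuning conditions -/

/-- The block matrix with blocks `c₂ ι₃ / 2 · I`, `-Qᵀ`, `-Q`, `I`. -/
def c₂Matrix {X : Type*} [Fintype X] [DecidableEq X] {p : ℕ}
    (Q : Matrix (Fin p) X ℝ) (ιlo c₂ : ℝ) : Matrix (X ⊕ Fin p) (X ⊕ Fin p) ℝ :=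
  Matrix.fromBlocks ((c₂ * ιlo / 2) • 1) (-Qᵀ) (-Q) 1

/-- The block `φ₄₄`. -/
def φ₄₄ {R X : Type*} [Fintype R] [Fintype X] {r : ℕ}
    (D₁ : Matrix X (Fin r) ℝ) (D₂ : Matrix R (Fin r) ℝ)
    (ιlo ιhi r₄ c₁ c₂ γ₁ γ : ℝ) : Matrix (Fin r) (Fin r) ℝ :=
  (8 * c₂ * ιhi ^ 2 / ιlo) • (D₁ᵀ * D₁)
    + (c₁ + 8 * c₂ * ιhi ^ 2 * r₄ * γ₁ / ιlo) • (D₂ᵀ * D₂) - γ • 1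

/-- The block `Φ₁₁`, with rows and columns split as
(output error, state, performance output, disturbance). -/
def Φ₁₁ {R X : Type*} [Fintype R] [DecidableEq R] [Fintype X] [DecidableEq X] {r p : ℕ}
    (Q : Matrix (Fin p) X ℝ) (W : Matrix (Fin p) (Fin r) ℝ)
    (D₁ : Matrix X (Fin r) ℝ) (D₂ : Matrix R (Fin r) ℝ)
    (T ιlo ιhi r₄ c₁ c₂ γ₁ γ : ℝ) :
    Matrix (R ⊕ (X ⊕ (Fin p ⊕ Fin r))) (R ⊕ (X ⊕ (Fin p ⊕ Fin r))) ℝ :=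
  Matrix.fromBlocks
    ((-c₁ + c₂ * T) • 1) 0
    0 (Matrix.fromBlocks
        (-(c₂ * ιlo / 2) • 1) (Matrix.fromCols Qᵀ 0)
        (Matrix.fromRows Q 0) (Matrix.fromBlocks
            (-1) W
            Wᵀ (φ₄₄ D₁ D₂ ιlo ιhi r₄ c₁ c₂ γ₁ γ)))

/-- The block `Φ₁₂`: the column `(0, 0, 0, -(2 c₁ / √(c₂ ι₃)) Δ̄₁ᵀ)`. -/
def Φ₁₂ (R : Type*) {X : Type*} {r : ℕ} (p : ℕ) (D₁ : Matrix X (Fin r) ℝ) (ιlo c₁ c₂ : ℝ) :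
    Matrix (R ⊕ (X ⊕ (Fin p ⊕ Fin r))) X ℝ :=
  Matrix.fromRows 0 (Matrix.fromRows 0 (Matrix.fromRows 0
    (-(2 * c₁ / √(c₂ * ιlo)) • D₁ᵀ)))

/-- The matrix of the linear matrix inequality. -/
def lmiMatrix {R X : Type*} [Fintype R] [DecidableEq R] [Fintype X] [DecidableEq X] {r p : ℕ}
    (Q : Matrix (Fin p) X ℝ) (W : Matrix (Fin p) (Fin r) ℝ)
    (D₁ : Matrix X (Fin r) ℝ) (D₂ : Matrix R (Fin r) ℝ)
    (T ιlo ιhi r₄ c₂ c₁ γ₁ γ₂ γ : ℝ) :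
    Matrix ((R ⊕ (X ⊕ (Fin p ⊕ Fin r))) ⊕ X) ((R ⊕ (X ⊕ (Fin p ⊕ Fin r))) ⊕ X) ℝ :=
  Matrix.fromBlocks
    (Φ₁₁ Q W D₁ D₂ T ιlo ιhi r₄ c₁ c₂ γ₁ γ) (Φ₁₂ R p D₁ ιlo c₁ c₂)
    (Φ₁₂ R p D₁ ιlo c₁ c₂)ᵀ (-γ₂ • 1)

/-- `(c₁, γ₁, γ₂, γ)` is a feasible point of the semidefinite program "minimize `γ`", with the
excitation bounds evaluated at the gain `α` and the norm bound `r₁`. The matrix inequality is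
required at all times, as `Δ̄₂(t)` and its number of rows depend on time. -/
structure SDPFeasible {n Ny N r p : ℕ} (S : SensorNetwork n Ny N) (K : Constants)
    (Δ₁ : Matrix (Fin N) (Fin r) ℝ) (Δ₂ : S.OutDisturbance r)
    (Q : Matrix (Fin p) (Fin n × Fin N) ℝ) (W : Matrix (Fin p) (Fin r) ℝ)
    (r₁ α c₂ c₁ γ₁ γ₂ γ : ℝ) : Prop where
  γ_pos : 0 < γ
  γ₂_le : 0 ≤ γ₁ - γ₂
  lmi : ∀ t, 0 ≤ t →
    (-lmiMatrix Q W (stackOnes n Δ₁) (Δ₂ t) K.T (K.ι₃lo n r₁ α) (K.ι₃hi n r₁ α) (K.r₄ α)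
      c₂ c₁ γ₁ γ₂ γ).PosSemidef

end CIEstimation

end

/-! ### Calculus of primitives -/

/-! Write `y = Λ̄ x`, `w = Δ̄₂ δ`, `v = y - w`, `d = Δ̄₁ δ`, so that `x' = -Γ̄ Λ̄ᵀ v - d`. Along a
trajectory the storage function `⟨Γ̄⁻¹ x, x⟩` has derivative `-(‖y‖² + ‖v‖²) + ‖w‖² - 2⟨Γ̄⁻¹ x, d⟩`.
Since `Γ̄ ≥ √γ₂`, the last term is at most `2 ‖x‖ f` with `f = ‖d‖ / √γ₂`, so the dissipated energy
`∫ (‖y‖² + ‖v‖²)` is bounded by the initial storage, `∫ ‖w‖²`, `∫ f²` and an arbitrarily small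
multiple of `∫ ‖x‖²`.

Excitation turns dissipation back into a bound on the state. The Gramian of `Λ̄` with the state
frozen is at least `ι₂` on every window of length `T` (`ι₂lo_mul_le_integral`). Estimating how far
`x` moves within a window, with `a = √φ₁`, bounds `ι₂ ‖x(t)‖²` by the integral over the window of
`(1 + a)² (‖y‖² + ‖v‖²)` plus a multiple of `f²` (`mul_norm_sq_le_integral_of_gramian`). Integrating
over `t` costs a factor `T`, and the small multiple of `∫ ‖x‖²` is absorbed
(`integral_sq_le_of_energy_of_window`, `integral_norm_sq_le_of_excitation`).

It remains to compare constants. The inequality `ι₃ (1 + a)² ≤ ι₂` (`ι₃lo_mul_le`), `‖Q x‖² ≤ (c₂ ι₃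
/ 2) ‖x‖²` and `c₂ T ≤ c₁` show that the weights of `∫ ‖w‖²` and `∫ f²` in the bound for `∫ ‖Q x‖²`
are at most `c₁` and `4 c₁² / (c₂ ι₃)` (`gain_constants_le`). The Schur complement of the matrix
inequality bounds exactly this weighted sum by `(γ - 1) ∫ ‖δ‖²` (`disturbance_energy_of_lmi`). The
missing `∫ ‖δ‖²` is the feedthrough: `Wᵀ W = 1` and `Qᵀ W = 0` give `‖z‖² = ‖Q x‖² + ‖δ‖²`. -/

/-- Product rule for primitives of integrable functions. -/
theorem mul_sub_mul_eq_integral_of_primitive {u v u' v' : ℝ → ℝ} {τ u₀ v₀ : ℝ} (hτ : 0 ≤ τ)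
    (hu' : IntervalIntegrable u' volume 0 τ) (hv' : IntervalIntegrable v' volume 0 τ)
    (hu : ∀ t ∈ Set.Icc 0 τ, u t = u₀ + ∫ s in (0 : ℝ)..t, u' s)
    (hv : ∀ t ∈ Set.Icc 0 τ, v t = v₀ + ∫ s in (0 : ℝ)..t, v' s) :
    u τ * v τ - u₀ * v₀ = ∫ s in (0 : ℝ)..τ, (u' s * v s + u s * v' s) := by
  -- Primitives of integrable functions are absolutely continuous, so integration by parts holds
  -- with the almost-everywhere derivatives, which are the integrands.
  have hac : ∀ {g : ℝ → ℝ} (c : ℝ), IntervalIntegrable g volume 0 τ →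
      AbsolutelyContinuousOnInterval (fun t => c + ∫ s in (0 : ℝ)..t, g s) 0 τ := by
    intro g c hg
    have h1 : AbsolutelyContinuousOnInterval (fun _ : ℝ => c) 0 τ :=
      (LipschitzWith.const c).lipschitzOnWith.absolutelyContinuousOnInterval
    exact h1.add (hg.absolutelyContinuousOnInterval_intervalIntegral Set.left_mem_uIcc)
  have key := (hac u₀ hu').integral_deriv_mul_eq_sub (hac v₀ hv')
  simp only [intervalIntegral.integral_same, add_zero] at key
  rw [hu τ ⟨hτ, le_rfl⟩, hv τ ⟨hτ, le_rfl⟩, ← key]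
  apply intervalIntegral.integral_congr_ae
  filter_upwards [hu'.ae_hasDerivAt_integral, hv'.ae_hasDerivAt_integral] with s h1 h2 hs
  have hs' : s ∈ Set.uIcc 0 τ := Set.uIoc_subset_uIcc hs
  have hd1 := ((h1 hs' 0 Set.left_mem_uIcc).const_add u₀).deriv
  have hd2 := ((h2 hs' 0 Set.left_mem_uIcc).const_add v₀).deriv
  rw [Set.uIcc_of_le hτ] at hs'
  rw [hd1, hd2, hu s hs', hv s hs']

/-- Chain rule for a quadratic form along a primitive. -/
theorem inner_sub_inner_eq_integral_of_primitive {X : Type*} [NormedAddCommGroup X]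
    [InnerProductSpace ℝ X] [FiniteDimensional ℝ X] {P : X →ₗ[ℝ] X} (hP : P.IsSymmetric)
    {x x' : ℝ → X} {x₀ : X} {τ : ℝ} (hτ : 0 ≤ τ) (hx' : IntervalIntegrable x' volume 0 τ)
    (hx : ∀ t ∈ Set.Icc 0 τ, x t = x₀ + ∫ s in (0 : ℝ)..t, x' s) :
    IntervalIntegrable (fun s => 2 * inner ℝ (P (x s)) (x' s)) volume 0 τ ∧
      inner ℝ (P (x τ)) (x τ) - inner ℝ (P x₀) x₀
        = ∫ s in (0 : ℝ)..τ, 2 * inner ℝ (P (x s)) (x' s) := by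
  let b := stdOrthonormalBasis ℝ X
  have hcomp : ∀ ℓ : X →L[ℝ] ℝ, IntervalIntegrable (fun s => ℓ (x' s)) volume 0 τ ∧
      ∀ t ∈ Set.Icc 0 τ, ℓ (x t) = ℓ x₀ + ∫ s in (0 : ℝ)..t, ℓ (x' s) := by
    intro ℓ
    refine ⟨⟨ℓ.integrable_comp hx'.1, ℓ.integrable_comp hx'.2⟩, fun t ht => ?_⟩
    rw [hx t ht, map_add, ContinuousLinearMap.intervalIntegral_comp_comm]
    exact hx'.mono_set (by
      rw [Set.uIcc_of_le ht.1, Set.uIcc_of_le hτ]; exact Set.Icc_subset_Icc_right ht.2)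
  have hxc : ContinuousOn x (Set.uIcc 0 τ) := by
    rw [Set.uIcc_of_le hτ]
    refine ContinuousOn.congr (f := fun t => x₀ + ∫ s in (0 : ℝ)..t, x' s) ?_ hx
    refine continuousOn_const.add ?_
    have := intervalIntegral.continuousOn_primitive_interval' hx' Set.left_mem_uIcc
    rwa [Set.uIcc_of_le hτ] at this
  -- In an orthonormal basis the form is a finite sum of products of scalar primitives; the symmetry
  -- of `P` later merges the two halves of each derivative.
  let ℓ₁ : Fin (Module.finrank ℝ X) → X →L[ℝ] ℝ := fun i =>
    (innerSL ℝ (b i)).comp (LinearMap.toContinuousLinearMap P)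
  let ℓ₂ : Fin (Module.finrank ℝ X) → X →L[ℝ] ℝ := fun i => innerSL ℝ (b i)
  have hsum : ∀ ξ η : X, inner ℝ (P ξ) η = ∑ i, ℓ₁ i ξ * ℓ₂ i η := by
    intro ξ η
    rw [← b.sum_inner_mul_inner (P ξ) η]
    exact Finset.sum_congr rfl fun i _ => by
      simp [ℓ₁, ℓ₂, real_inner_comm]
  have hpt : (fun s => 2 * inner ℝ (P (x s)) (x' s)) = fun s =>
      ∑ i, (ℓ₁ i (x' s) * ℓ₂ i (x s) + ℓ₁ i (x s) * ℓ₂ i (x' s)) := by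
    funext s
    rw [Finset.sum_add_distrib, ← hsum, ← hsum, hP (x' s) (x s), real_inner_comm (x' s), two_mul]
  have hint : ∀ i ∈ Finset.univ, IntervalIntegrable
      (fun s => ℓ₁ i (x' s) * ℓ₂ i (x s) + ℓ₁ i (x s) * ℓ₂ i (x' s)) volume 0 τ := fun i _ =>
    ((hcomp (ℓ₁ i)).1.mul_continuousOn ((ℓ₂ i).continuous.comp_continuousOn hxc)).add
      ((hcomp (ℓ₂ i)).1.continuousOn_mul ((ℓ₁ i).continuous.comp_continuousOn hxc))
  rw [hpt]
  refine ⟨?_, ?_⟩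
  · have h := IntervalIntegrable.sum Finset.univ hint
    simpa only [Finset.sum_fn] using h
  · rw [intervalIntegral.integral_finsetSum hint, hsum, hsum, ← Finset.sum_sub_distrib]
    exact Finset.sum_congr rfl fun i _ => mul_sub_mul_eq_integral_of_primitive hτ (hcomp (ℓ₁ i)).1
      (hcomp (ℓ₂ i)).1 (hcomp (ℓ₁ i)).2 (hcomp (ℓ₂ i)).2

/-- Cauchy-Schwarz inequality on an interval. -/
theorem sq_intervalIntegral_le {h : ℝ → ℝ} {a b : ℝ} (hab : a ≤ b)
    (h1 : IntervalIntegrable h volume a b)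
    (h2 : IntervalIntegrable (fun s => h s ^ 2) volume a b) :
    (∫ s in a..b, h s) ^ 2 ≤ (b - a) * ∫ s in a..b, h s ^ 2 := by
  rcases hab.eq_or_lt with rfl | hlt
  · simp
  -- With `m` the mean value, the inequality is the nonnegativity of the variance.
  set m := (∫ s in a..b, h s) / (b - a) with hm
  have hpos : 0 < b - a := sub_pos.2 hlt
  have h0 : 0 ≤ ∫ s in a..b, (h s - m) ^ 2 :=
    intervalIntegral.integral_nonneg hab fun s _ => sq_nonneg _
  have h3 : ∫ s in a..b, (h s - m) ^ 2
      = (∫ s in a..b, h s ^ 2) - 2 * m * (∫ s in a..b, h s) + (b - a) * m ^ 2 := by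
    have : ∀ s, (h s - m) ^ 2 = h s ^ 2 - 2 * m * h s + m ^ 2 := fun s => by ring
    simp only [this]
    rw [intervalIntegral.integral_add (h2.sub (h1.const_mul _)) intervalIntegrable_const,
      intervalIntegral.integral_sub h2 (h1.const_mul _), intervalIntegral.integral_const_mul,
      intervalIntegral.integral_const, smul_eq_mul]
  have h4 : (∫ s in a..b, h s) = m * (b - a) := by rw [hm]; field_simp
  rw [h3, h4] at h0
  rw [h4]
  nlinarith

/-! ### L² estimates from dissipation and observability on windows -/

/-- Integrating a bound by sliding windows of length `T`. -/
theorem integral_le_of_sliding_window {p q : ℝ → ℝ} {T τ : ℝ} (hT : 0 ≤ T) (hτ : T ≤ τ)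
    (hq : ∀ t, 0 ≤ q t) (hqi : IntervalIntegrable q volume 0 τ)
    (hpi : IntervalIntegrable p volume 0 (τ - T))
    (hw : ∀ t, 0 ≤ t → p t ≤ ∫ s in t..t + T, q s) :
    ∫ t in (0 : ℝ)..τ - T, p t ≤ T * ∫ t in (0 : ℝ)..τ, q t := by
  have hτ0 : 0 ≤ τ := hT.trans hτ
  have hsub : ∀ a ∈ Set.Icc 0 τ, ∀ b ∈ Set.Icc 0 τ, IntervalIntegrable q volume a b :=
    fun a ha b hb => hqi.mono_set (by
      rw [Set.uIcc_of_le hτ0]; exact Set.uIcc_subset_Icc ha hb)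
  set G : ℝ → ℝ := fun t => ∫ s in (0 : ℝ)..t, q s with hG
  have hGc : ContinuousOn G (Set.Icc 0 τ) := by
    have := intervalIntegral.continuousOn_primitive_interval' hqi Set.left_mem_uIcc
    rwa [Set.uIcc_of_le hτ0] at this
  have hGi : ∀ a ∈ Set.Icc 0 τ, ∀ b ∈ Set.Icc 0 τ, IntervalIntegrable G volume a b :=
    fun a ha b hb => (hGc.mono (Set.uIcc_subset_Icc ha hb)).intervalIntegrable
  have m0 : (0 : ℝ) ∈ Set.Icc 0 τ := ⟨le_rfl, hτ0⟩
  have mT : T ∈ Set.Icc 0 τ := ⟨hT, hτ⟩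
  have mτ : τ ∈ Set.Icc 0 τ := ⟨hτ0, le_rfl⟩
  have mτT : τ - T ∈ Set.Icc 0 τ := ⟨by linarith, by linarith⟩
  have hshift : IntervalIntegrable (fun t => G (t + T)) volume 0 (τ - T) := by
    simpa using (hGi T mT τ mτ).comp_add_right T
  calc ∫ t in (0 : ℝ)..τ - T, p t ≤ ∫ t in (0 : ℝ)..τ - T, (G (t + T) - G t) := by
        refine intervalIntegral.integral_mono_on (by linarith) hpi
          (hshift.sub (hGi 0 m0 _ mτT)) fun t ht => ?_
        have ht1 : t ∈ Set.Icc 0 τ := ⟨ht.1, by linarith [ht.2]⟩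
        have ht2 : t + T ∈ Set.Icc 0 τ := ⟨by linarith [ht.1], by linarith [ht.2]⟩
        rw [hG]
        simp only
        rw [intervalIntegral.integral_interval_sub_left (hsub _ m0 _ ht2) (hsub _ m0 _ ht1)]
        exact hw t ht.1
    -- After the shift by `T` only the last and the first window survive; the last is at most `T * G
    -- τ` because `G` is increasing, the first is nonnegative.
    _ = (∫ t in τ - T..τ, G t) - ∫ t in (0 : ℝ)..T, G t := by
        rw [intervalIntegral.integral_sub hshift (hGi 0 m0 _ mτT),
          intervalIntegral.integral_comp_add_right]
        simp only [zero_add, sub_add_cancel]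
        have e1 := intervalIntegral.integral_add_adjacent_intervals (hGi _ m0 _ mT) (hGi _ mT _ mτ)
        have e2 := intervalIntegral.integral_add_adjacent_intervals (hGi _ m0 _ mτT)
          (hGi _ mτT _ mτ)
        linarith
    _ ≤ (∫ _ in τ - T..τ, G τ) - 0 := by
        refine sub_le_sub ?_ ?_
        · refine intervalIntegral.integral_mono_on (by linarith) (hGi _ mτT _ mτ)
            intervalIntegrable_const fun t ht => ?_
          have ht1 : t ∈ Set.Icc 0 τ := ⟨by linarith [ht.1], ht.2⟩
          rw [← sub_nonneg]
          simp only [hG]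
          rw [intervalIntegral.integral_interval_sub_left (hsub _ m0 _ mτ) (hsub _ m0 _ ht1)]
          exact intervalIntegral.integral_nonneg ht.2 fun s _ => hq s
        · exact intervalIntegral.integral_nonneg hT fun t ht =>
            intervalIntegral.integral_nonneg ht.1 fun s _ => hq s
    _ = T * ∫ t in (0 : ℝ)..τ, q t := by simp [hG]

/-- A function that is dominated by sliding-window integrals of a dissipated quantity `m` and of
`f²` is square integrable on the half line, if the dissipated quantity and the function itself obey
an energy estimate. -/
theorem integral_sq_le_of_energy_of_window {ξ m f : ℝ → ℝ} {T R κ₁ κ₂ V E F : ℝ}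
    (hT : 0 < T) (hR : 0 ≤ R) (hκ₁ : 0 < κ₁) (hκ₂ : 0 ≤ κ₂)
    (hξ : ContinuousOn ξ (Set.Ici 0)) (hm0 : ∀ t, 0 ≤ m t)
    (hm : ∀ τ, 0 ≤ τ → IntervalIntegrable m volume 0 τ)
    (hf : ∀ τ, 0 ≤ τ → IntervalIntegrable (fun s => f s ^ 2) volume 0 τ)
    (hfF : ∀ τ, 0 ≤ τ → ∫ s in (0 : ℝ)..τ, f s ^ 2 ≤ F)
    (henergy : ∀ ε, 0 < ε → ∀ τ, 0 ≤ τ →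
      ∫ s in (0 : ℝ)..τ, m s ≤ V + E + ε * (∫ s in (0 : ℝ)..τ, ξ s ^ 2) + F / ε)
    (hstate : ∀ ε, 0 < ε → ∀ τ, 0 ≤ τ →
      ξ τ ^ 2 ≤ R * (V + E + ε * (∫ s in (0 : ℝ)..τ, ξ s ^ 2) + F / ε))
    (hwindow : ∀ t, 0 ≤ t → ξ t ^ 2 ≤ ∫ s in t..t + T, (κ₁ * m s + κ₂ * f s ^ 2)) :
    IntegrableOn (fun s => ξ s ^ 2) (Set.Ioi 0) ∧
      ∫ s in Set.Ioi 0, ξ s ^ 2 ≤ 2 * (T * κ₁) * (V + E)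
        + (4 * (T * κ₁) ^ 2 + 2 * (T * κ₂)) * F := by
  have hi : ∀ a b, 0 ≤ a → 0 ≤ b → IntervalIntegrable (fun s => ξ s ^ 2) volume a b := by
    intro a b ha hb
    refine ContinuousOn.intervalIntegrable ((hξ.pow 2).mono fun s hs => ?_)
    exact (le_min ha hb).trans hs.1
  have hmono : ∀ a b, 0 ≤ a → a ≤ b → ∫ s in (0 : ℝ)..a, ξ s ^ 2 ≤ ∫ s in (0 : ℝ)..b, ξ s ^ 2 := by
    intro a b ha hab
    rw [← intervalIntegral.integral_add_adjacent_intervals (hi 0 a le_rfl ha)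
      (hi a b ha (ha.trans hab))]
    linarith [intervalIntegral.integral_nonneg (μ := volume) hab fun s _ => sq_nonneg (ξ s)]
  have hAB : ∀ ε, 0 < ε → ∀ τ, T ≤ τ → ∫ s in (0 : ℝ)..τ - T, ξ s ^ 2
      ≤ T * κ₁ * (V + E + ε * (∫ s in (0 : ℝ)..τ, ξ s ^ 2) + F / ε) + T * κ₂ * F := by
    intro ε hε τ hτ
    have hτ0 : 0 ≤ τ := hT.le.trans hτ
    have h1 := integral_le_of_sliding_window hT.le hτ
      (fun t => add_nonneg (mul_nonneg hκ₁.le (hm0 t)) (mul_nonneg hκ₂ (sq_nonneg (f t))))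
      (((hm τ hτ0).const_mul κ₁).add ((hf τ hτ0).const_mul κ₂))
      (hi 0 (τ - T) le_rfl (by linarith)) hwindow
    rw [intervalIntegral.integral_add ((hm τ hτ0).const_mul κ₁) ((hf τ hτ0).const_mul κ₂),
      intervalIntegral.integral_const_mul, intervalIntegral.integral_const_mul] at h1
    have h2 := mul_le_mul_of_nonneg_left (henergy ε hε τ hτ0) (mul_pos hT hκ₁).le
    have h3 := mul_le_mul_of_nonneg_left (hfF τ hτ0) (mul_nonneg hT.le hκ₂)
    linarith
  have hA : 0 < T * κ₁ := mul_pos hT hκ₁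
  have hB : 0 ≤ T * κ₂ := mul_nonneg hT.le hκ₂
  set A := T * κ₁
  set B := T * κ₂
  -- Finiteness comes first: the window bound reaches only to `τ - T`, while the energy term
  -- involves the integral up to `τ`. The remaining window is covered by `hstate`, and `ε = 1 /
  -- (2H)` absorbs half of the integral. This bound is not sharp.
  obtain ⟨M, hM⟩ : ∃ M, ∀ τ, T ≤ τ → ∫ s in (0 : ℝ)..τ, ξ s ^ 2 ≤ M := by
    set H := A + T * R with hH
    have hHpos : 0 < H := by positivity
    refine ⟨2 * H * (V + E + F / (1 / (2 * H))) + 2 * B * F, fun τ hτ => ?_⟩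
    have hτ0 : 0 ≤ τ := hT.le.trans hτ
    set J := ∫ s in (0 : ℝ)..τ, ξ s ^ 2 with hJ
    have hε : 0 < 1 / (2 * H) := by positivity
    have h1 := hAB _ hε τ hτ
    have h2 : ∫ s in τ - T..τ, ξ s ^ 2
        ≤ T * (R * (V + E + 1 / (2 * H) * J + F / (1 / (2 * H)))) := by
      calc ∫ s in τ - T..τ, ξ s ^ 2
          ≤ ∫ _ in τ - T..τ, R * (V + E + 1 / (2 * H) * J + F / (1 / (2 * H))) := by
            refine intervalIntegral.integral_mono_on (by linarith)
              (hi _ _ (by linarith) hτ0) intervalIntegrable_const fun s hs => ?_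
            have hs0 : 0 ≤ s := by linarith [hs.1]
            refine (hstate _ hε s hs0).trans ?_
            gcongr
            exact hmono s τ hs0 hs.2
        _ = _ := by rw [intervalIntegral.integral_const, sub_sub_cancel, smul_eq_mul]
    have h3 := intervalIntegral.integral_add_adjacent_intervals
      (hi 0 (τ - T) le_rfl (by linarith)) (hi (τ - T) τ (by linarith) hτ0)
    have h4 : J ≤ H * (V + E + 1 / (2 * H) * J + F / (1 / (2 * H))) + B * F := by
      rw [hH]; rw [hH] at h1 h2
      nlinarith
    have h5 : H * (1 / (2 * H) * J) = J / 2 := by field_simp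
    nlinarith
  have hint : IntegrableOn (fun s => ξ s ^ 2) (Set.Ioi 0) := by
    refine integrableOn_Ioi_of_intervalIntegral_norm_bounded (l := Filter.atTop) (b := id) M 0
      (fun τ => ?_) Filter.tendsto_id ?_
    · rcases le_total 0 τ with h | h
      · exact (hi 0 τ le_rfl h).1
      · simp [Set.Ioc_eq_empty_of_le h]
    · filter_upwards [Filter.eventually_ge_atTop T] with τ hτ
      simpa using hM τ hτ
  refine ⟨hint, ?_⟩
  have hlim := intervalIntegral_tendsto_integral_Ioi (0 : ℝ) hint (Filter.tendsto_id)
  have hlim' : Filter.Tendsto (fun τ : ℝ => ∫ s in (0 : ℝ)..τ - T, ξ s ^ 2) Filter.atTop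
      (nhds (∫ s in Set.Ioi 0, ξ s ^ 2)) :=
    intervalIntegral_tendsto_integral_Ioi (0 : ℝ) hint
      (Filter.tendsto_atTop_add_const_right _ (-T) Filter.tendsto_id)
  -- In the limit both integrals agree, so the last window costs nothing and `ε = 1 / (2A)` gives
  -- the sharper constants.
  have hε : 0 < 1 / (2 * A) := by positivity
  have hle := le_of_tendsto_of_tendsto hlim'
    ((((hlim.const_mul (1 / (2 * A))).const_add (V + E)).add_const (F / (1 / (2 * A)))).const_mul A
      |>.add_const (B * F)) (by
      filter_upwards [Filter.eventually_ge_atTop T] with τ hτ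
      exact hAB _ hε τ hτ)
  set J := ∫ s in Set.Ioi 0, ξ s ^ 2
  have h1 : A * (1 / (2 * A) * J) = J / 2 := by field_simp
  have h2 : A * (F / (1 / (2 * A))) = 2 * A ^ 2 * F := by field_simp
  nlinarith

/-- Observability estimate on one window: the state at the left end is bounded by the energies of
the output `y`, of the injected output `v` and of the drift bound `f`. -/
theorem mul_norm_sq_le_integral_of_gramian {X Y : Type*} [NormedAddCommGroup X]
    [NormedSpace ℝ X] [NormedAddCommGroup Y] [NormedSpace ℝ Y]
    {Λ : ℝ → X →ₗ[ℝ] Y} {x x' : ℝ → X} {y v : ℝ → Y} {f : ℝ → ℝ} {t T R ρ ι a : ℝ}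
    (hT : 0 < T) (hR : 0 < R) (hρ : 0 < ρ) (ha0 : 0 < a) (ha : a ^ 2 = R ^ 2 * (T * ρ ^ 2) ^ 2 / 2)
    (hf0 : ∀ s, 0 ≤ f s)
    (hx'i : IntervalIntegrable x' volume t (t + T))
    (hx : ∀ s ∈ Set.Icc t (t + T), x s - x t = ∫ u in t..s, x' u)
    (hx' : ∀ s ∈ Set.Icc t (t + T), ‖x' s‖ ≤ R * (ρ * ‖v s‖ + f s))
    (hΛ : ∀ s ∈ Set.Icc t (t + T), ∀ ξ, ‖Λ s ξ‖ ≤ ρ * ‖ξ‖)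
    (hy : ∀ s, y s = Λ s (x s))
    (hgram : ι * ‖x t‖ ^ 2 ≤ ∫ s in t..t + T, ‖Λ s (x t)‖ ^ 2)
    (hgi : IntervalIntegrable (fun s => ‖Λ s (x t)‖ ^ 2) volume t (t + T))
    (hyL : MemLp y 2 (volume.restrict (Set.Ioc t (t + T))))
    (hvL : MemLp v 2 (volume.restrict (Set.Ioc t (t + T))))
    (hfL : MemLp f 2 (volume.restrict (Set.Ioc t (t + T)))) :
    ι * ‖x t‖ ^ 2 ≤ ∫ s in t..t + T,
      ((1 + a) ^ 2 * (‖y s‖ ^ 2 + ‖v s‖ ^ 2) + (1 + a) ^ 2 * a / ρ ^ 2 * f s ^ 2) := by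
  have htT : t ≤ t + T := by linarith
  set h : ℝ → ℝ := fun s => ρ * ‖v s‖ + f s with hh
  have hh0 : ∀ s, 0 ≤ h s := fun s => add_nonneg (mul_nonneg hρ.le (norm_nonneg _)) (hf0 s)
  have hhL : MemLp h 2 (volume.restrict (Set.Ioc t (t + T))) := (hvL.norm.const_mul ρ).add hfL
  have hhi : IntervalIntegrable h volume t (t + T) :=
    (intervalIntegrable_iff_integrableOn_Ioc_of_le htT).2 (hhL.integrable one_le_two)
  have hh2 : IntervalIntegrable (fun s => h s ^ 2) volume t (t + T) :=
    (intervalIntegrable_iff_integrableOn_Ioc_of_le htT).2 hhL.integrable_sq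
  have hy2 : IntervalIntegrable (fun s => ‖y s‖ ^ 2) volume t (t + T) :=
    (intervalIntegrable_iff_integrableOn_Ioc_of_le htT).2 hyL.norm.integrable_sq
  have hv2 : IntervalIntegrable (fun s => ‖v s‖ ^ 2) volume t (t + T) :=
    (intervalIntegrable_iff_integrableOn_Ioc_of_le htT).2 hvL.norm.integrable_sq
  have hf2 : IntervalIntegrable (fun s => f s ^ 2) volume t (t + T) :=
    (intervalIntegrable_iff_integrableOn_Ioc_of_le htT).2 hfL.integrable_sq
  set B := ∫ s in t..t + T, h s ^ 2 with hB
  have hB0 : 0 ≤ B := intervalIntegral.integral_nonneg htT fun s _ => sq_nonneg _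
  -- Keeping the factor `s - t` from Cauchy-Schwarz, instead of `T`, produces `T ^ 2 / 2` after
  -- integration, and hence the factor `1 / 2` in `a ^ 2`.
  have hdiff : ∀ s ∈ Set.Icc t (t + T), ‖x s - x t‖ ^ 2 ≤ R ^ 2 * ((s - t) * B) := by
    intro s hs
    have hsub : Set.uIcc t s ⊆ Set.uIcc t (t + T) := by
      rw [Set.uIcc_of_le hs.1, Set.uIcc_of_le htT]; exact Set.Icc_subset_Icc_right hs.2
    have h1 : ‖x s - x t‖ ≤ R * ∫ u in t..s, h u := by
      rw [hx s hs, ← intervalIntegral.integral_const_mul]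
      refine (intervalIntegral.norm_integral_le_integral_norm hs.1).trans ?_
      refine intervalIntegral.integral_mono_on hs.1 (hx'i.mono_set hsub).norm
        ((hhi.mono_set hsub).const_mul R) fun u hu => ?_
      exact hx' u ⟨hu.1, hu.2.trans hs.2⟩
    have h2 := sq_intervalIntegral_le hs.1 (hhi.mono_set hsub) (hh2.mono_set hsub)
    have h3 : ∫ u in t..s, h u ^ 2 ≤ B :=
      intervalIntegral.integral_mono_interval le_rfl hs.1 hs.2
        (Filter.Eventually.of_forall fun u => sq_nonneg _) hh2
    calc ‖x s - x t‖ ^ 2 ≤ (R * ∫ u in t..s, h u) ^ 2 := by gcongr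
      _ = R ^ 2 * (∫ u in t..s, h u) ^ 2 := by ring
      _ ≤ R ^ 2 * ((s - t) * B) := by
        have : 0 ≤ s - t := sub_nonneg.2 hs.1
        gcongr
        exact h2.trans (by gcongr)
  -- Young's inequality with weight `a`, applied to `Λ s (x t) = y s - Λ s (x s - x t)`.
  have hpt : ∀ s ∈ Set.Icc t (t + T), ‖Λ s (x t)‖ ^ 2
      ≤ (1 + a) * ‖y s‖ ^ 2 + (1 + 1 / a) * (ρ ^ 2 * R ^ 2 * B) * (s - t) := by
    intro s hs
    have h1 : Λ s (x t) = y s - Λ s (x s - x t) := by rw [hy, map_sub]; abel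
    have h2 : ‖Λ s (x s - x t)‖ ^ 2 ≤ ρ ^ 2 * (R ^ 2 * ((s - t) * B)) := by
      calc ‖Λ s (x s - x t)‖ ^ 2 ≤ (ρ * ‖x s - x t‖) ^ 2 := by gcongr; exact hΛ s hs _
        _ = ρ ^ 2 * ‖x s - x t‖ ^ 2 := by ring
        _ ≤ _ := by gcongr; exact hdiff s hs
    set q := ‖Λ s (x s - x t)‖
    have h3 : ‖Λ s (x t)‖ ≤ ‖y s‖ + q := by rw [h1]; exact norm_sub_le _ _
    have h4 : (‖y s‖ + q) ^ 2 ≤ (1 + a) * ‖y s‖ ^ 2 + (1 + 1 / a) * q ^ 2 := by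
      have : 0 ≤ (a * ‖y s‖ - q) ^ 2 / a := by positivity
      have h5 : (a * ‖y s‖ - q) ^ 2 / a = a * ‖y s‖ ^ 2 - 2 * ‖y s‖ * q + 1 / a * q ^ 2 := by
        field_simp; ring
      nlinarith
    calc ‖Λ s (x t)‖ ^ 2 ≤ (‖y s‖ + q) ^ 2 := by gcongr
      _ ≤ (1 + a) * ‖y s‖ ^ 2 + (1 + 1 / a) * q ^ 2 := h4
      _ ≤ (1 + a) * ‖y s‖ ^ 2 + (1 + 1 / a) * (ρ ^ 2 * (R ^ 2 * ((s - t) * B))) := by gcongr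
      _ = _ := by ring
  have hlin : IntervalIntegrable (fun s => (1 + 1 / a) * (ρ ^ 2 * R ^ 2 * B) * (s - t))
      volume t (t + T) := by
    apply Continuous.intervalIntegrable; fun_prop
  have hT2 : ∫ s in t..t + T, (s - t) = T ^ 2 / 2 := by
    rw [intervalIntegral.integral_comp_sub_right (fun s => s) t]; simp
  have hcoef : (1 + 1 / a) * (ρ ^ 2 * R ^ 2 * B) * (T ^ 2 / 2) = (1 + a) * (a / ρ ^ 2 * B) := by
    have : R ^ 2 * (T ^ 2) * ρ ^ 4 = 2 * a ^ 2 := by rw [ha]; ring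
    field_simp
    linear_combination (a + 1) * B * this
  calc ι * ‖x t‖ ^ 2 ≤ ∫ s in t..t + T, ‖Λ s (x t)‖ ^ 2 := hgram
    _ ≤ ∫ s in t..t + T,
        ((1 + a) * ‖y s‖ ^ 2 + (1 + 1 / a) * (ρ ^ 2 * R ^ 2 * B) * (s - t)) :=
      intervalIntegral.integral_mono_on htT hgi ((hy2.const_mul _).add hlin) hpt
    _ = ∫ s in t..t + T, ((1 + a) * ‖y s‖ ^ 2 + (1 + a) * (a / ρ ^ 2 * h s ^ 2)) := by
      rw [intervalIntegral.integral_add (hy2.const_mul _) hlin,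
        intervalIntegral.integral_add (hy2.const_mul _) ((hh2.const_mul _).const_mul _),
        intervalIntegral.integral_const_mul ((1 + 1 / a) * (ρ ^ 2 * R ^ 2 * B)), hT2, hcoef,
        intervalIntegral.integral_const_mul (1 + a) (fun s => a / ρ ^ 2 * h s ^ 2),
        intervalIntegral.integral_const_mul (a / ρ ^ 2)]
    _ ≤ _ := by
      refine intervalIntegral.integral_mono_on htT
        ((hy2.const_mul _).add ((hh2.const_mul _).const_mul _))
        (((hy2.add hv2).const_mul _).add (hf2.const_mul _)) fun s _ => ?_
      -- The defect of this splitting of `h` is a perfect square; its weight is chosen so that `v`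
      -- enters with the same total factor `(1 + a) ^ 2` as `y`.
      have h1 : a / ρ ^ 2 * h s ^ 2 ≤ (1 + a) * ‖v s‖ ^ 2 + a * (1 + a) / ρ ^ 2 * f s ^ 2 := by
        have h2 : (1 + a) * ‖v s‖ ^ 2 + a * (1 + a) / ρ ^ 2 * f s ^ 2 - a / ρ ^ 2 * h s ^ 2
            = (‖v s‖ - a * f s / ρ) ^ 2 := by
          simp only [hh]; field_simp; ring
        nlinarith [sq_nonneg (‖v s‖ - a * f s / ρ)]
      have h3 : (1 + a) * ‖y s‖ ^ 2 ≤ (1 + a) ^ 2 * ‖y s‖ ^ 2 := by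
        gcongr; nlinarith
      have h4 := mul_le_mul_of_nonneg_left h1 (by linarith : (0 : ℝ) ≤ 1 + a)
      have h5 : (1 + a) * ((1 + a) * ‖v s‖ ^ 2 + a * (1 + a) / ρ ^ 2 * f s ^ 2)
          = (1 + a) ^ 2 * ‖v s‖ ^ 2 + (1 + a) ^ 2 * a / ρ ^ 2 * f s ^ 2 := by ring
      linarith

/-- `L₂` estimate for the state of `x' = -Γ Λᵀ (Λ x - w) - d` under excitation of `Λ`, with
`P = Γ⁻¹`; the function `f` bounds the drift `d` relative to `Γ`. -/
theorem integral_norm_sq_le_of_excitation {X Y : Type*} [NormedAddCommGroup X]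
    [InnerProductSpace ℝ X] [FiniteDimensional ℝ X] [NormedAddCommGroup Y] [InnerProductSpace ℝ Y]
    {Λ : ℝ → X →ₗ[ℝ] Y} {Λa : ℝ → Y →ₗ[ℝ] X} {Γ P : X →ₗ[ℝ] X} {x d : ℝ → X} {w : ℝ → Y}
    {f : ℝ → ℝ} {x₀ : X} {T R ρ ι a : ℝ}
    (hT : 0 < T) (hR : 0 < R) (hρ : 0 < ρ) (hι : 0 < ι) (ha0 : 0 < a)
    (ha : a ^ 2 = R ^ 2 * (T * ρ ^ 2) ^ 2 / 2) (hf0 : ∀ s, 0 ≤ f s)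
    (hadj : ∀ s η ξ, inner ℝ (Λa s η) ξ = inner ℝ η (Λ s ξ))
    (hP : P.IsSymmetric) (hPΓ : ∀ ξ η, inner ℝ (P ξ) (Γ η) = inner ℝ ξ η)
    (hΓ : ∀ ξ, ‖Γ ξ‖ ≤ R * ‖ξ‖) (hPR : ∀ ξ, ‖ξ‖ ^ 2 ≤ R * inner ℝ (P ξ) ξ)
    (hPd : ∀ s, 0 ≤ s → ∀ ξ, |inner ℝ (P ξ) (d s)| ≤ ‖ξ‖ * f s)
    (hd : ∀ s, 0 ≤ s → ‖d s‖ ≤ R * f s)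
    (hx'i : ∀ t, 0 ≤ t →
      IntervalIntegrable (fun s => -Γ (Λa s (Λ s (x s) - w s)) - d s) volume 0 t)
    (hx : ∀ t, 0 ≤ t → x t = x₀ + ∫ s in (0 : ℝ)..t, (-Γ (Λa s (Λ s (x s) - w s)) - d s))
    (hΛ : ∀ s, 0 ≤ s → ∀ ξ, ‖Λ s ξ‖ ≤ ρ * ‖ξ‖)
    (hgram : ∀ t, 0 ≤ t → ∀ ξ, ι * ‖ξ‖ ^ 2 ≤ ∫ s in t..t + T, ‖Λ s ξ‖ ^ 2)
    (hgi : ∀ t, 0 ≤ t → ∀ ξ, IntervalIntegrable (fun s => ‖Λ s ξ‖ ^ 2) volume t (t + T))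
    (hym : ContinuousOn x (Set.Ici 0) →
      AEStronglyMeasurable (fun s => Λ s (x s)) (volume.restrict (Set.Ioi 0)))
    (hw : MemLp w 2 (volume.restrict (Set.Ioi 0)))
    (hf : MemLp f 2 (volume.restrict (Set.Ioi 0))) :
    ContinuousOn x (Set.Ici 0) ∧ IntegrableOn (fun s => ‖x s‖ ^ 2) (Set.Ioi 0) ∧
      ∫ s in Set.Ioi 0, ‖x s‖ ^ 2
        ≤ 2 * (T * ((1 + a) ^ 2 / ι)) *
            (inner ℝ (P x₀) x₀ + ∫ s in Set.Ioi 0, ‖w s‖ ^ 2)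
        + (4 * (T * ((1 + a) ^ 2 / ι)) ^ 2 + 2 * (T * ((1 + a) ^ 2 * a / ρ ^ 2 / ι)))
          * ∫ s in Set.Ioi 0, f s ^ 2 := by
  set x' : ℝ → X := fun s => -Γ (Λa s (Λ s (x s) - w s)) - d s with hx'def
  set y : ℝ → Y := fun s => Λ s (x s) with hydef
  set v : ℝ → Y := fun s => y s - w s with hvdef
  have hxc : ContinuousOn x (Set.Ici 0) := by
    have hloc : ∀ τ, 0 ≤ τ → ContinuousOn x (Set.Icc 0 τ) := by
      intro τ hτ
      refine ContinuousOn.congr (f := fun t => x₀ + ∫ s in (0 : ℝ)..t, x' s) ?_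
        fun t ht => hx t ht.1
      have := intervalIntegral.continuousOn_primitive_interval' (hx'i τ hτ) Set.left_mem_uIcc
      rw [Set.uIcc_of_le hτ] at this
      exact continuousOn_const.add this
    intro t ht
    have ht' : (0 : ℝ) ≤ t := ht
    refine ((hloc (t + 1) (by linarith)) t ⟨ht', by linarith⟩).mono_of_mem_nhdsWithin ?_
    filter_upwards [self_mem_nhdsWithin,
      mem_nhdsWithin_of_mem_nhds (Iio_mem_nhds (show t < t + 1 by linarith))] with s h1 h2
    exact ⟨h1, h2.le⟩
  have hsubset : ∀ t τ : ℝ, 0 ≤ t →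
      volume.restrict (Set.Ioc t τ) ≤ volume.restrict (Set.Ioi 0) := fun t τ ht =>
    Measure.restrict_mono (fun s hs => lt_of_le_of_lt ht hs.1) le_rfl
  -- Only local square integrability of `y` is available here: `x` is continuous, hence bounded on
  -- compact intervals.
  have hyL : ∀ t τ : ℝ, 0 ≤ t → MemLp y 2 (volume.restrict (Set.Ioc t τ)) := by
    intro t τ ht
    obtain ⟨C, hC⟩ := (isCompact_Icc (a := t) (b := τ)).exists_bound_of_continuousOn
      (hxc.mono fun s hs => ht.trans hs.1)
    refine MemLp.of_bound ((hym hxc).mono_measure (hsubset t τ ht)) (ρ * C) ?_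
    refine (ae_restrict_iff' measurableSet_Ioc).2 (Filter.Eventually.of_forall fun s hs => ?_)
    refine (hΛ s (ht.trans hs.1.le) _).trans ?_
    gcongr
    exact hC s ⟨hs.1.le, hs.2⟩
  have hwL : ∀ t τ : ℝ, 0 ≤ t → MemLp w 2 (volume.restrict (Set.Ioc t τ)) := fun t τ ht =>
    hw.mono_measure (hsubset t τ ht)
  have hfL : ∀ t τ : ℝ, 0 ≤ t → MemLp f 2 (volume.restrict (Set.Ioc t τ)) := fun t τ ht =>
    hf.mono_measure (hsubset t τ ht)
  have hvL : ∀ t τ : ℝ, 0 ≤ t → MemLp v 2 (volume.restrict (Set.Ioc t τ)) := fun t τ ht =>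
    (hyL t τ ht).sub (hwL t τ ht)
  have hy2 : ∀ τ, 0 ≤ τ → IntervalIntegrable (fun s => ‖y s‖ ^ 2) volume 0 τ := fun τ hτ =>
    (intervalIntegrable_iff_integrableOn_Ioc_of_le hτ).2 (hyL 0 τ le_rfl).norm.integrable_sq
  have hv2 : ∀ τ, 0 ≤ τ → IntervalIntegrable (fun s => ‖v s‖ ^ 2) volume 0 τ := fun τ hτ =>
    (intervalIntegrable_iff_integrableOn_Ioc_of_le hτ).2 (hvL 0 τ le_rfl).norm.integrable_sq
  have hw2 : ∀ τ, 0 ≤ τ → IntervalIntegrable (fun s => ‖w s‖ ^ 2) volume 0 τ := fun τ hτ =>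
    (intervalIntegrable_iff_integrableOn_Ioc_of_le hτ).2 (hwL 0 τ le_rfl).norm.integrable_sq
  have hf2 : ∀ τ, 0 ≤ τ → IntervalIntegrable (fun s => f s ^ 2) volume 0 τ := fun τ hτ =>
    (intervalIntegrable_iff_integrableOn_Ioc_of_le hτ).2 (hfL 0 τ le_rfl).integrable_sq
  have hx2 : ∀ τ, 0 ≤ τ → IntervalIntegrable (fun s => ‖x s‖ ^ 2) volume 0 τ := by
    intro τ hτ
    refine ContinuousOn.intervalIntegrable ((hxc.norm.pow 2).mono fun s hs => ?_)
    rw [Set.uIcc_of_le hτ] at hs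
    exact hs.1
  have htail : ∀ g : ℝ → ℝ, (∀ s, 0 ≤ g s) → IntegrableOn g (Set.Ioi 0) → ∀ τ, 0 ≤ τ →
      ∫ s in (0 : ℝ)..τ, g s ≤ ∫ s in Set.Ioi 0, g s := by
    intro g hg hgi τ hτ
    rw [intervalIntegral.integral_of_le hτ]
    exact setIntegral_mono_set hgi (Filter.Eventually.of_forall hg)
      (Filter.Eventually.of_forall fun s hs => hs.1)
  set E := ∫ s in Set.Ioi 0, ‖w s‖ ^ 2 with hE
  set F := ∫ s in Set.Ioi 0, f s ^ 2 with hF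
  have hEle : ∀ τ, 0 ≤ τ → ∫ s in (0 : ℝ)..τ, ‖w s‖ ^ 2 ≤ E :=
    htail _ (fun s => sq_nonneg _) hw.norm.integrable_sq
  have hFle : ∀ τ, 0 ≤ τ → ∫ s in (0 : ℝ)..τ, f s ^ 2 ≤ F :=
    htail _ (fun s => sq_nonneg _) hf.integrable_sq
  have henergy : ∀ ε, 0 < ε → ∀ τ, 0 ≤ τ →
      inner ℝ (P (x τ)) (x τ) + ∫ s in (0 : ℝ)..τ, (‖y s‖ ^ 2 + ‖v s‖ ^ 2)
        ≤ inner ℝ (P x₀) x₀ + E + ε * (∫ s in (0 : ℝ)..τ, ‖x s‖ ^ 2) + F / ε := by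
    intro ε hε τ hτ
    obtain ⟨hi, heq⟩ := inner_sub_inner_eq_integral_of_primitive hP hτ (hx'i τ hτ)
      fun t ht => hx t ht.1
    have hneg : IntervalIntegrable (fun s => -(‖y s‖ ^ 2 + ‖v s‖ ^ 2)) volume 0 τ :=
      ((hy2 τ hτ).add (hv2 τ hτ)).neg
    have hle : ∫ s in (0 : ℝ)..τ, 2 * inner ℝ (P (x s)) (x' s) ≤ ∫ s in (0 : ℝ)..τ,
        (-(‖y s‖ ^ 2 + ‖v s‖ ^ 2) + ‖w s‖ ^ 2 + ε * ‖x s‖ ^ 2 + 1 / ε * f s ^ 2) := by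
      refine intervalIntegral.integral_mono_on hτ hi
        (((hneg.add (hw2 τ hτ)).add ((hx2 τ hτ).const_mul ε)).add
          ((hf2 τ hτ).const_mul (1 / ε))) fun s hs => ?_
      have h1 : inner ℝ (P (x s)) (x' s)
          = -inner ℝ (v s) (y s) - inner ℝ (P (x s)) (d s) := by
        simp only [hx'def]
        rw [inner_sub_right, inner_neg_right, hPΓ, real_inner_comm, hadj]
      -- Polarization keeps both `‖y‖²` and `‖v‖²` as dissipation; the window estimate uses both.
      have h2 : ‖w s‖ ^ 2 = ‖y s‖ ^ 2 - 2 * inner ℝ (v s) (y s) + ‖v s‖ ^ 2 := by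
        have : w s = y s - v s := by simp [hvdef]
        rw [this, norm_sub_sq_real, real_inner_comm]
      have h3 := (abs_le.1 (hPd s hs.1 (x s))).1
      have h4 : 2 * (‖x s‖ * f s) ≤ ε * ‖x s‖ ^ 2 + 1 / ε * f s ^ 2 := by
        have h5 : 0 ≤ (ε * ‖x s‖ - f s) ^ 2 / ε := by positivity
        have h6 : (ε * ‖x s‖ - f s) ^ 2 / ε
            = ε * ‖x s‖ ^ 2 - 2 * (‖x s‖ * f s) + 1 / ε * f s ^ 2 := by
          field_simp; ring
        linarith
      rw [h1]
      linarith
    rw [intervalIntegral.integral_add ((hneg.add (hw2 τ hτ)).add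
        ((hx2 τ hτ).const_mul ε)) ((hf2 τ hτ).const_mul (1 / ε)),
      intervalIntegral.integral_add (hneg.add (hw2 τ hτ))
        ((hx2 τ hτ).const_mul ε),
      intervalIntegral.integral_add hneg (hw2 τ hτ),
      intervalIntegral.integral_neg, intervalIntegral.integral_const_mul ε,
      intervalIntegral.integral_const_mul (1 / ε)] at hle
    have h7 := hEle τ hτ
    have h8 : 1 / ε * ∫ s in (0 : ℝ)..τ, f s ^ 2 ≤ F / ε := by
      rw [div_eq_inv_mul F, one_div]
      gcongr
      exact hFle τ hτ
    linarith
  -- The adjoint inherits the norm bound of `Λ`.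
  have hΛa : ∀ s, 0 ≤ s → ∀ η, ‖Λa s η‖ ≤ ρ * ‖η‖ := by
    intro s hs η
    have h1 : ‖Λa s η‖ ^ 2 ≤ ‖η‖ * (ρ * ‖Λa s η‖) := by
      rw [← real_inner_self_eq_norm_sq, hadj]
      exact (real_inner_le_norm _ _).trans (by gcongr; exact hΛ s hs _)
    rcases (norm_nonneg (Λa s η)).eq_or_lt with h0 | h0
    · rw [← h0]; positivity
    · nlinarith
  have hkey := integral_sq_le_of_energy_of_window (ξ := fun s => ‖x s‖)
    (m := fun s => ‖y s‖ ^ 2 + ‖v s‖ ^ 2) (f := f) (T := T) (R := R) (κ₁ := (1 + a) ^ 2 / ι)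
    (κ₂ := (1 + a) ^ 2 * a / ρ ^ 2 / ι) (V := inner ℝ (P x₀) x₀) (E := E) (F := F) hT hR.le
    (by positivity) (by positivity) hxc.norm (fun t => by positivity)
    (fun τ hτ => (hy2 τ hτ).add (hv2 τ hτ)) hf2 hFle ?_ ?_ ?_
  · exact ⟨hxc, hkey⟩
  · intro ε hε τ hτ
    have h1 := henergy ε hε τ hτ
    have h2 : 0 ≤ inner ℝ (P (x τ)) (x τ) :=
      nonneg_of_mul_nonneg_right ((sq_nonneg _).trans (hPR (x τ))) hR
    linarith
  · intro ε hε τ hτ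
    refine (hPR (x τ)).trans ?_
    have h1 := henergy ε hε τ hτ
    have h2 : 0 ≤ ∫ s in (0 : ℝ)..τ, (‖y s‖ ^ 2 + ‖v s‖ ^ 2) :=
      intervalIntegral.integral_nonneg hτ fun s _ => by positivity
    gcongr
    linarith
  · intro t ht
    have htT : 0 ≤ t + T := by linarith
    have hx'w : ∀ s ∈ Set.Icc t (t + T), IntervalIntegrable x' volume t s := fun s hs =>
      (hx'i s (ht.trans hs.1)).mono_set (by
        rw [Set.uIcc_of_le hs.1, Set.uIcc_of_le (ht.trans hs.1)]
        exact Set.Icc_subset_Icc_left ht)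
    have h := mul_norm_sq_le_integral_of_gramian (Λ := Λ) (x := x) (x' := x') (y := y) (v := v)
      (f := f) (t := t) (T := T) (R := R) (ρ := ρ) (ι := ι) (a := a) hT hR hρ ha0 ha hf0
      (hx'w _ ⟨by linarith, le_rfl⟩) ?_ ?_ (fun s hs => hΛ s (ht.trans hs.1)) (fun _ => rfl)
      (hgram t ht _) (hgi t ht _) (hyL t _ ht) (hvL t _ ht) (hfL t _ ht)
    · have h9 : ∀ s, (1 + a) ^ 2 / ι * (‖y s‖ ^ 2 + ‖v s‖ ^ 2)
          + (1 + a) ^ 2 * a / ρ ^ 2 / ι * f s ^ 2 = 1 / ι * ((1 + a) ^ 2 *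
            (‖y s‖ ^ 2 + ‖v s‖ ^ 2) + (1 + a) ^ 2 * a / ρ ^ 2 * f s ^ 2) := fun s => by ring
      simp only [h9]
      rw [intervalIntegral.integral_const_mul, one_div, ← div_eq_inv_mul, le_div_iff₀ hι]
      linarith
    · intro s hs
      rw [hx s (ht.trans hs.1), hx t ht,
        ← intervalIntegral.integral_add_adjacent_intervals (hx'i t ht) (hx'w s hs)]
      abel
    · intro s hs
      have hs0 := ht.trans hs.1
      calc ‖x' s‖ ≤ ‖Γ (Λa s (v s))‖ + ‖d s‖ := by
            simp only [hx'def]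
            refine (norm_sub_le _ _).trans ?_
            rw [norm_neg]
        _ ≤ R * (ρ * ‖v s‖) + R * f s :=
            add_le_add ((hΓ _).trans (by gcongr; exact hΛa s hs0 _)) (hd s hs0)
        _ = R * (ρ * ‖v s‖ + f s) := by ring

/-! ### Quadratic forms of matrices -/

theorem norm_toLp_sq_eq_dotProduct {ι : Type*} [Fintype ι] (u : ι → ℝ) :
    ‖WithLp.toLp 2 u‖ ^ 2 = u ⬝ᵥ u := by
  rw [EuclideanSpace.real_norm_sq_eq]
  simp [dotProduct, sq]

theorem dotProduct_self_nonneg {ι : Type*} [Fintype ι] (u : ι → ℝ) : 0 ≤ u ⬝ᵥ u :=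
  Finset.sum_nonneg fun _ _ => mul_self_nonneg _

theorem abs_dotProduct_le {ι : Type*} [Fintype ι] (u v : ι → ℝ) :
    |u ⬝ᵥ v| ≤ ‖WithLp.toLp 2 u‖ * ‖WithLp.toLp 2 v‖ := by
  have := abs_real_inner_le_norm (WithLp.toLp 2 v) (WithLp.toLp 2 u)
  rw [EuclideanSpace.inner_toLp_toLp] at this
  simpa [mul_comm] using this

theorem norm_toLp_mulVec_le {ι κ : Type*} [Fintype ι] [Fintype κ] [DecidableEq κ]
    (A : Matrix ι κ ℝ) (v : κ → ℝ) :
    ‖WithLp.toLp 2 (A *ᵥ v)‖ ≤ ‖A‖ * ‖WithLp.toLp 2 v‖ :=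
  l2_opNorm_mulVec A (WithLp.toLp 2 v)

theorem abs_dotProduct_mulVec_le {ι κ : Type*} [Fintype ι] [Fintype κ] [DecidableEq κ]
    (A : Matrix ι κ ℝ) (u : ι → ℝ) (v : κ → ℝ) :
    |u ⬝ᵥ A *ᵥ v| ≤ ‖A‖ * ‖WithLp.toLp 2 u‖ * ‖WithLp.toLp 2 v‖ := by
  refine (abs_dotProduct_le u (A *ᵥ v)).trans ?_
  calc ‖WithLp.toLp 2 u‖ * ‖WithLp.toLp 2 (A *ᵥ v)‖
      ≤ ‖WithLp.toLp 2 u‖ * (‖A‖ * ‖WithLp.toLp 2 v‖) := by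
        gcongr; exact norm_toLp_mulVec_le A v
    _ = _ := by ring

theorem abs_entry_le_l2_opNorm {ι κ : Type*} [Fintype ι] [DecidableEq ι] [Fintype κ]
    [DecidableEq κ] (A : Matrix ι κ ℝ) (i : ι) (j : κ) : |A i j| ≤ ‖A‖ := by
  simpa using abs_dotProduct_mulVec_le A (Pi.single i 1) (Pi.single j 1)

theorem dotProduct_transpose_mul_mulVec {ι κ κ' : Type*} [Fintype ι] [Fintype κ] [Fintype κ']
    (A : Matrix ι κ ℝ) (B : Matrix ι κ' ℝ) (u : κ → ℝ) (v : κ' → ℝ) :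
    u ⬝ᵥ (Aᵀ * B) *ᵥ v = A *ᵥ u ⬝ᵥ B *ᵥ v := by
  rw [← mulVec_mulVec, dotProduct_mulVec, vecMul_transpose]

/-- The spectral gap of a symmetric matrix whose kernel is spanned by the vector of ones. -/
theorem mul_le_dotProduct_mulVec_of_spectral_gap {n : ℕ} (hn : 0 < n)
    {M : Matrix (Fin n) (Fin n) ℝ} (hM : M.IsHermitian) (h1 : M *ᵥ (fun _ => 1) = 0) {lam : ℝ}
    (hlam : 0 < lam) {i₀ : Fin n} (hi : ∀ i, i ≠ i₀ → lam ≤ hM.eigenvalues i) (h0 : hM.eigenvalues i₀ = 0)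
    (u : Fin n → ℝ) :
    lam * (u ⬝ᵥ u - (∑ i, u i) ^ 2 / n) ≤ u ⬝ᵥ M *ᵥ u := by
  set b := hM.eigenvectorBasis
  set U : EuclideanSpace ℝ (Fin n) := WithLp.toLp 2 u
  set O : EuclideanSpace ℝ (Fin n) := WithLp.toLp 2 (fun _ => 1)
  have hMb : ∀ i (w : Fin n → ℝ),
      inner ℝ (b i) (WithLp.toLp 2 (M *ᵥ w)) = hM.eigenvalues i * inner ℝ (b i) (WithLp.toLp 2 w) := by
    intro i w
    have hMt : Mᵀ = M := by rw [← conjTranspose_eq_transpose_of_trivial]; exact hM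
    have := hM.mulVec_eigenvectorBasis i
    rw [EuclideanSpace.inner_eq_star_dotProduct, EuclideanSpace.inner_eq_star_dotProduct]
    simp only [star_trivial]
    rw [dotProduct_comm, dotProduct_mulVec, ← mulVec_transpose, hMt, this, smul_dotProduct,
      smul_eq_mul, dotProduct_comm]
  -- Eigenvectors with positive eigenvalue are orthogonal to the kernel vector `O`, so `O` lies
  -- along `b i₀` and the `i₀` coordinate of `u` is determined by the sum of its entries.
  have hOb : ∀ i, i ≠ i₀ → inner ℝ (b i) O = 0 := by
    intro i hne
    have h := hMb i (fun _ => 1)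
    rw [h1] at h
    have hz : WithLp.toLp 2 (0 : Fin n → ℝ) = 0 := rfl
    rw [hz, inner_zero_right] at h
    rcases mul_eq_zero.1 h.symm with h' | h'
    · linarith [hi i hne]
    · exact h'
  have hOO : inner ℝ (b i₀) O ^ 2 = n := by
    have h := b.sum_sq_inner_right O
    rw [Finset.sum_eq_single i₀ (fun i _ hne => by rw [hOb i hne]; simp) (by simp),
      norm_toLp_sq_eq_dotProduct] at h
    simpa [dotProduct] using h
  have hOU : inner ℝ (b i₀) O * inner ℝ (b i₀) U = ∑ i, u i := by
    have h := b.sum_inner_mul_inner O U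
    rw [Finset.sum_eq_single i₀ (fun i _ hne => by rw [real_inner_comm, hOb i hne]; simp)
      (by simp), real_inner_comm] at h
    rw [h, EuclideanSpace.inner_toLp_toLp]
    simp [dotProduct]
  have hn' : (0 : ℝ) < n := by exact_mod_cast hn
  have hU : inner ℝ (b i₀) U ^ 2 = (∑ i, u i) ^ 2 / n := by
    rw [← hOU, mul_pow, hOO]; field_simp
  have hsum : u ⬝ᵥ u = ∑ i, inner ℝ (b i) U ^ 2 := by
    rw [b.sum_sq_inner_right U, norm_toLp_sq_eq_dotProduct]
  have hquad : u ⬝ᵥ M *ᵥ u = ∑ i, hM.eigenvalues i * inner ℝ (b i) U ^ 2 := by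
    have h := b.sum_inner_mul_inner U (WithLp.toLp 2 (M *ᵥ u))
    rw [EuclideanSpace.inner_toLp_toLp, star_trivial, dotProduct_comm] at h
    rw [← h]
    refine Finset.sum_congr rfl fun i _ => ?_
    rw [hMb, real_inner_comm]; ring
  rw [hsum, hquad, ← hU, ← Finset.add_sum_erase _ _ (Finset.mem_univ i₀),
    ← Finset.add_sum_erase _ _ (Finset.mem_univ i₀), h0, add_sub_cancel_left, zero_mul, zero_add,
    Finset.mul_sum]
  exact Finset.sum_le_sum fun i hi' =>
    mul_le_mul_of_nonneg_right (hi i (Finset.ne_of_mem_erase hi')) (sq_nonneg _)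

/-! ### Integrated matrices and the network data -/

namespace CIEstimation

theorem dotProduct_matIntegral_mulVec {ι : Type*} [Fintype ι] {A : ℝ → Matrix ι ι ℝ} {a b : ℝ}
    (hA : ∀ i j, IntervalIntegrable (fun s => A s i j) volume a b) (u : ι → ℝ) :
    IntervalIntegrable (fun s => u ⬝ᵥ A s *ᵥ u) volume a b ∧
      u ⬝ᵥ matIntegral A a b *ᵥ u = ∫ s in a..b, u ⬝ᵥ A s *ᵥ u := by
  have hi : ∀ i j, IntervalIntegrable (fun s => u i * (A s i j * u j)) volume a b :=
    fun i j => ((hA i j).mul_const _).const_mul _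
  have hi' : ∀ i, IntervalIntegrable (fun s => ∑ j, u i * (A s i j * u j)) volume a b := fun i => by
    simpa only [Finset.sum_fn] using IntervalIntegrable.sum Finset.univ fun j _ => hi i j
  simp only [dotProduct, mulVec, Finset.mul_sum]
  refine ⟨by simpa only [Finset.sum_fn] using IntervalIntegrable.sum Finset.univ fun i _ => hi' i,
    ?_⟩
  rw [intervalIntegral.integral_finsetSum fun i _ => hi' i]
  refine Finset.sum_congr rfl fun i _ => ?_
  rw [intervalIntegral.integral_finsetSum fun j _ => hi i j]
  refine Finset.sum_congr rfl fun j _ => ?_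
  rw [intervalIntegral.integral_const_mul, intervalIntegral.integral_mul_const]
  rfl

/-- A measurable matrix function that is bounded on `[0, ∞)` has integrable entries. -/
theorem intervalIntegrable_entry_of_norm_le {ι κ : Type*} [Fintype ι] [DecidableEq ι] [Fintype κ]
    [DecidableEq κ] {A : ℝ → Matrix ι κ ℝ} (hA : ∀ i j, Measurable fun s => A s i j) {c : ℝ}
    (hc : ∀ s, 0 ≤ s → ‖A s‖ ≤ c) {a b : ℝ} (ha : 0 ≤ a) (hb : 0 ≤ b) (i : ι) (j : κ) :
    IntervalIntegrable (fun s => A s i j) volume a b := by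
  refine (intervalIntegrable_const (c := c)).mono_fun (hA i j).aestronglyMeasurable ?_
  refine (ae_restrict_iff' measurableSet_uIoc).2 (Filter.Eventually.of_forall fun s hs => ?_)
  have hs0 : 0 ≤ s := (le_min ha hb).trans hs.1.le
  exact ((abs_entry_le_l2_opNorm (A s) i j).trans (hc s hs0)).trans (le_abs_self c)

variable {n Ny N : ℕ}

/-- Each column of the incidence matrix sums to `1 - 1 = 0`. This needs source and sink to differ,
which the asymmetry of an orientation guarantees. -/
theorem laplacian_mulVec_one {G : SimpleGraph (Fin n)} (o : Orientation G) :
    laplacian o *ᵥ (fun _ => 1) = 0 := by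
  have h : (incidence o)ᵀ *ᵥ (fun _ => (1 : ℝ)) = 0 := by
    funext e
    have hne : e.1.1 ≠ e.1.2 := fun h => by
      have h1 := e.2
      have h2 : (e.1.1, e.1.2) ∈ o.edges := h1
      have h3 := o.asymm _ _ h2
      rw [h] at h2 h3
      exact h3 h2
    have hsplit : ∀ i : Fin n, (if i = e.1.1 then (1 : ℝ) else if i = e.1.2 then -1 else 0)
        = (if i = e.1.1 then 1 else 0) + if i = e.1.2 then -1 else 0 := by
      intro i
      by_cases h1 : i = e.1.1
      · simp [h1, hne]
      · simp [h1]
    simp [mulVec, dotProduct, incidence, hsplit, Finset.sum_add_distrib]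
  rw [laplacian, ← mulVec_mulVec, h, mulVec_zero]

namespace SensorNetwork

variable (S : SensorNetwork n Ny N)

/-- Summing over all ordered pairs removes the time dependence of the index set, so that
measurability in `t` can be checked term by term. -/
theorem sum_edges_eq_sum_ite (t : ℝ) (g : Fin n × Fin n → ℝ) :
    ∑ e : (S.orient t).edges, g e = ∑ e, if e ∈ (S.orient t).edges then g e else 0 := by
  rw [Finset.sum_coe_sort (S.orient t).edges g, Finset.sum_ite_mem, Finset.univ_inter]

theorem measurable_L (i j : Fin n) : Measurable fun t => S.L t i j := by
  have h : ∀ t, S.L t i j = ∑ e : Fin n × Fin n, if e ∈ (S.orient t).edges then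
      (if i = e.1 then 1 else if i = e.2 then -1 else 0) *
        (if j = e.1 then 1 else if j = e.2 then -1 else (0 : ℝ)) else 0 := by
    intro t
    rw [← sum_edges_eq_sum_ite S t fun e => (if i = e.1 then 1 else if i = e.2 then -1 else 0) *
        (if j = e.1 then 1 else if j = e.2 then -1 else (0 : ℝ))]
    rfl
  simp only [h]
  exact Finset.measurable_fun_sum _ fun e _ =>
    Measurable.ite (S.measurableSet_edge e.1 e.2) measurable_const measurable_const

theorem measurable_regressor_gram (i : Fin n) (k l : Fin N) :
    Measurable fun t => ((S.C i t)ᵀ * S.C i t) k l := by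
  simp only [Matrix.mul_apply, transpose_apply]
  exact Finset.measurable_fun_sum _ fun m _ => (S.measurable_C i m k).mul (S.measurable_C i m l)

/-- The stacked output splits into the local measurements and the consensus part. -/
theorem dotProduct_Lam_mulVec {α : ℝ} (hα : 0 ≤ α) (t : ℝ) (ξ : Fin n × Fin N → ℝ) :
    S.Lam α t *ᵥ ξ ⬝ᵥ S.Lam α t *ᵥ ξ
      = ∑ i, (S.C i t *ᵥ fun l => ξ (i, l)) ⬝ᵥ (S.C i t *ᵥ fun l => ξ (i, l))
        + α * ∑ l, (fun i => ξ (i, l)) ⬝ᵥ S.L t *ᵥ fun i => ξ (i, l) := by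
  rw [Lam, fromRows_mulVec, sumElim_dotProduct_sumElim]
  congr 1
  · rw [dotProduct, Fintype.sum_prod_type]
    refine Finset.sum_congr rfl fun i _ => ?_
    refine Finset.sum_congr rfl fun k _ => ?_
    have : (blkDiag (fun i => S.C i t) *ᵥ ξ) (i, k) = (S.C i t *ᵥ fun l => ξ (i, l)) k := by
      simp [mulVec, dotProduct, blkDiag, Fintype.sum_prod_type, ite_mul]
    rw [this]
  · have h : ∀ e l, (((incidence (S.orient t))ᵀ ⊗ₖ (1 : Matrix (Fin N) (Fin N) ℝ)) *ᵥ ξ) (e, l)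
        = ((incidence (S.orient t))ᵀ *ᵥ fun i => ξ (i, l)) e := by
      intro e l
      simp [mulVec, dotProduct, Fintype.sum_prod_type, kroneckerMap_apply, Matrix.one_apply]
    rw [smul_mulVec, smul_dotProduct, dotProduct_smul, smul_smul, Real.mul_self_sqrt hα,
      smul_eq_mul]
    congr 1
    rw [dotProduct, Fintype.sum_prod_type, Finset.sum_comm]
    refine Finset.sum_congr rfl fun l _ => ?_
    simp only [h]
    rw [L, laplacian, ← transpose_transpose (incidence (S.orient t)),
      transpose_transpose (incidence (S.orient t))ᵀ, dotProduct_transpose_mul_mulVec]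
    rfl

end SensorNetwork
-- Inequalities between the excitation bounds
namespace Constants

theorem ι₂lo_nonneg {n : ℕ} {K : Constants} {α : ℝ} (hα : 0 ≤ α) (hlam : 0 ≤ K.lam) :
    0 ≤ K.ι₂lo n α := by
  refine Real.sInf_nonneg ?_
  rintro _ ⟨ρ, hρ, rfl⟩
  refine le_max_of_le_left (mul_nonneg (mul_nonneg hα hlam) ?_)
  nlinarith [hρ.1, hρ.2]

theorem ι₂lo_le {n : ℕ} {K : Constants} {α : ℝ} (hα : 0 ≤ α) (hlam : 0 ≤ K.lam) {ρ : ℝ}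
    (hρ : ρ ∈ Set.Icc (0 : ℝ) 1) :
    K.ι₂lo n α ≤ max (α * K.lam * (1 - ρ ^ 2))
      (K.ι₁lo / n * ρ ^ 2 - 2 * K.r₂ * K.T * √(ρ ^ 2 * (1 - ρ ^ 2))) := by
  refine csInf_le ⟨0, ?_⟩ ⟨ρ, hρ, rfl⟩
  rintro _ ⟨ρ, hρ, rfl⟩
  refine le_max_of_le_left (mul_nonneg (mul_nonneg hα hlam) ?_)
  nlinarith [hρ.1, hρ.2]

/-- Unified form of the two cases of the definition of `ι₃`. -/
theorem ι₃lo_eq {n : ℕ} {K : Constants} {r₁ α : ℝ} (h0 : 0 ≤ K.ι₂lo n α)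
    (hle : K.ι₂lo n α ≤ K.ι₂hi α) (hhi : 0 < K.ι₂hi α) :
    K.ι₃lo n r₁ α = (K.ι₂lo n α /
      (√(K.ι₂hi α - K.ι₂lo n α + K.φ₁ r₁ α * K.ι₂lo n α) + √(K.ι₂hi α))) ^ 2 := by
  have hφ : 0 ≤ K.φ₁ r₁ α := by unfold φ₁; positivity
  unfold ι₃lo
  split_ifs with h
  · rw [h, one_mul, sub_add_cancel, ← two_mul, div_pow, mul_pow, Real.sq_sqrt hhi.le]
    norm_num
  · have hne : K.φ₁ r₁ α - 1 ≠ 0 := sub_ne_zero.2 h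
    have hrad : 0 ≤ K.ι₂hi α - K.ι₂lo n α + K.φ₁ r₁ α * K.ι₂lo n α :=
      add_nonneg (sub_nonneg.2 hle) (mul_nonneg hφ h0)
    have hpos : 0 < √(K.ι₂hi α) := Real.sqrt_pos.2 hhi
    congr 1
    rw [div_eq_div_iff hne (by positivity)]
    have e1 := Real.mul_self_sqrt hrad
    have e2 := Real.mul_self_sqrt hhi.le
    -- Rationalization: the two radicands differ by exactly `(φ₁ - 1) * ι₂`.
    linear_combination e1 - e2

/-- In the unified form `ι₃ = (ι₂ / D)²`, the inequality `ι₂ ≤ ῑ₂` bounds the two roots in `D` below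
by `a √ι₂` and `√ι₂`, so `D ≥ (1 + a) √ι₂`. This links the tuning constant `ι₃` to the window
estimate. -/
theorem ι₃lo_mul_le {n : ℕ} {K : Constants} {r₁ α a : ℝ} (h0 : 0 < K.ι₂lo n α)
    (hle : K.ι₂lo n α ≤ K.ι₂hi α) (ha : 0 ≤ a) (hφ : K.φ₁ r₁ α = a ^ 2) :
    K.ι₃lo n r₁ α * (1 + a) ^ 2 ≤ K.ι₂lo n α := by
  rw [ι₃lo_eq h0.le hle (h0.trans_le hle), hφ]
  set ι := K.ι₂lo n α
  set D := √(K.ι₂hi α - ι + a ^ 2 * ι) + √(K.ι₂hi α)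
  have hs : 0 < √ι := Real.sqrt_pos.2 h0
  have h1 : a * √ι ≤ √(K.ι₂hi α - ι + a ^ 2 * ι) := by
    refine Real.le_sqrt_of_sq_le ?_
    rw [mul_pow, Real.sq_sqrt h0.le]
    linarith
  have h2 : √ι ≤ √(K.ι₂hi α) := Real.sqrt_le_sqrt hle
  have h3 : (1 + a) * √ι ≤ D := by simp only [D]; linarith
  have hD : 0 < D := lt_of_lt_of_le (by positivity) h3
  have h4 : ((1 + a) * √ι) ^ 2 ≤ D ^ 2 := by gcongr
  rw [mul_pow, Real.sq_sqrt h0.le] at h4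
  rw [div_pow, div_mul_eq_mul_div, div_le_iff₀ (by positivity)]
  nlinarith

end Constants

/-! ### Bounds of the Gramian under excitation -/

variable {n Ny N : ℕ}

theorem dotProduct_self_eq_sum_rows (ξ : Fin n × Fin N → ℝ) :
    ξ ⬝ᵥ ξ = ∑ i, (fun l => ξ (i, l)) ⬝ᵥ fun l => ξ (i, l) := by
  simp [dotProduct, Fintype.sum_prod_type]

theorem dotProduct_self_eq_sum_cols (ξ : Fin n × Fin N → ℝ) :
    ξ ⬝ᵥ ξ = ∑ l, (fun i => ξ (i, l)) ⬝ᵥ fun i => ξ (i, l) := by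
  simp only [dotProduct, Fintype.sum_prod_type]
  rw [Finset.sum_comm]

namespace Excitation

variable {S : SensorNetwork n Ny N} {K : Constants}

/-- The regressors act sensor by sensor and the Laplacian coordinate by coordinate, so the two
bounds are summed over rows and over columns of the state. -/
theorem Lam_mulVec_le (hexc : Excitation S K) {α : ℝ} (hα : 0 ≤ α) {t : ℝ} (ht : 0 ≤ t)
    (ξ : Fin n × Fin N → ℝ) :
    S.Lam α t *ᵥ ξ ⬝ᵥ S.Lam α t *ᵥ ξ ≤ K.r₄ α * (ξ ⬝ᵥ ξ) := by
  rw [S.dotProduct_Lam_mulVec hα, Constants.r₄, add_mul, mul_assoc]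
  refine add_le_add ?_ (mul_le_mul_of_nonneg_left ?_ hα)
  · rw [dotProduct_self_eq_sum_rows, Finset.mul_sum]
    refine Finset.sum_le_sum fun i _ => ?_
    rw [← dotProduct_transpose_mul_mulVec]
    refine (le_abs_self _).trans ((abs_dotProduct_mulVec_le _ _ _).trans ?_)
    rw [mul_assoc, ← sq, norm_toLp_sq_eq_dotProduct]
    exact mul_le_mul_of_nonneg_right (hexc.regressor_le i t ht) (dotProduct_self_nonneg _)
  · rw [dotProduct_self_eq_sum_cols, Finset.mul_sum]
    refine Finset.sum_le_sum fun l _ => ?_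
    refine (le_abs_self _).trans ((abs_dotProduct_mulVec_le _ _ _).trans ?_)
    rw [mul_assoc, ← sq, norm_toLp_sq_eq_dotProduct]
    exact mul_le_mul_of_nonneg_right (hexc.laplacian_le t ht) (dotProduct_self_nonneg _)

/-- Excitation of the consensus directions by the integrated Laplacian. -/
theorem integral_laplacian_ge (hexc : Excitation S K) (hn : 0 < n) {t : ℝ} (ht : K.T ≤ t)
    (u : Fin n → ℝ) :
    IntervalIntegrable (fun s => u ⬝ᵥ S.L s *ᵥ u) volume (t - K.T) t ∧
      K.lam * (u ⬝ᵥ u - (∑ i, u i) ^ 2 / n) ≤ ∫ s in t - K.T..t, u ⬝ᵥ S.L s *ᵥ u := by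
  have hT := hexc.T_pos
  obtain ⟨i₀, h0, hi⟩ := hexc.connected t ht
  have hint := fun i j => intervalIntegrable_entry_of_norm_le S.measurable_L hexc.laplacian_le
    (a := t - K.T) (b := t) (by linarith) (by linarith) i j
  obtain ⟨h1, h2⟩ := dotProduct_matIntegral_mulVec hint u
  refine ⟨h1, ?_⟩
  rw [← h2]
  refine mul_le_dotProduct_mulVec_of_spectral_gap hn _ ?_ hexc.lam_pos hi h0 u
  funext i
  have h3 : ∀ s, ∑ j, S.L s i j = 0 := fun s => by
    have := congrFun (laplacian_mulVec_one (S.orient s)) i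
    simpa [mulVec, dotProduct, SensorNetwork.L] using this
  have h4 : ∑ j, ∫ s in t - K.T..t, S.L s i j = 0 := by
    rw [← intervalIntegral.integral_finsetSum fun j _ => hint i j]
    simp [h3]
  simpa [mulVec, dotProduct, matIntegral] using h4

/-- Excitation of the common component `a` by the regressors, for blocks `a + βᵢ`. -/
theorem integral_regressor_ge (hexc : Excitation S K) {t : ℝ} (ht : K.T ≤ t)
    (a : Fin N → ℝ) (β : Fin n → Fin N → ℝ) :
    IntervalIntegrable (fun s => ∑ i, (S.C i s *ᵥ (a + β i)) ⬝ᵥ (S.C i s *ᵥ (a + β i)))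
        volume (t - K.T) t ∧
      K.ι₁lo * (a ⬝ᵥ a) - 2 * K.r₂ * K.T * (‖WithLp.toLp 2 a‖ * ∑ i, ‖WithLp.toLp 2 (β i)‖)
        ≤ ∫ s in t - K.T..t, ∑ i, (S.C i s *ᵥ (a + β i)) ⬝ᵥ (S.C i s *ᵥ (a + β i)) := by
  have hT := hexc.T_pos
  have hint : ∀ i k l, IntervalIntegrable (fun s => ((S.C i s)ᵀ * S.C i s) k l) volume
      (t - K.T) t := fun i k l =>
    intervalIntegrable_entry_of_norm_le (S.measurable_regressor_gram i)
      (fun s hs => hexc.regressor_le i s hs) (by linarith) (by linarith) k l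
  have hi : IntervalIntegrable (fun s => ∑ i, (S.C i s *ᵥ (a + β i)) ⬝ᵥ (S.C i s *ᵥ (a + β i)))
      volume (t - K.T) t := by
    have h := IntervalIntegrable.sum Finset.univ fun i _ =>
      (dotProduct_matIntegral_mulVec (hint i) (a + β i)).1
    simp only [dotProduct_transpose_mul_mulVec] at h
    simpa only [Finset.sum_fn] using h
  have hint' : ∀ k l, IntervalIntegrable (fun s => (∑ i, (S.C i s)ᵀ * S.C i s) k l) volume
      (t - K.T) t := fun k l => by
    have h := IntervalIntegrable.sum Finset.univ fun i _ => hint i k l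
    simp only [Matrix.sum_apply]
    simpa only [Finset.sum_fn] using h
  obtain ⟨h1, h2⟩ := dotProduct_matIntegral_mulVec hint' a
  refine ⟨hi, ?_⟩
  have hlow : K.ι₁lo * (a ⬝ᵥ a) ≤ ∫ s in t - K.T..t, a ⬝ᵥ (∑ i, (S.C i s)ᵀ * S.C i s) *ᵥ a := by
    rw [← h2]
    have h := (hexc.cpe_lower t ht).dotProduct_mulVec_nonneg a
    rw [sub_mulVec, smul_mulVec, one_mulVec, star_trivial, dotProduct_sub, dotProduct_smul,
      smul_eq_mul] at h
    linarith
  set c := 2 * K.r₂ * (‖WithLp.toLp 2 a‖ * ∑ i, ‖WithLp.toLp 2 (β i)‖)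
  calc _ ≤ (∫ s in t - K.T..t, a ⬝ᵥ (∑ i, (S.C i s)ᵀ * S.C i s) *ᵥ a) - K.T * c := by
        simp only [c]; linarith
    _ = ∫ s in t - K.T..t, (a ⬝ᵥ (∑ i, (S.C i s)ᵀ * S.C i s) *ᵥ a - c) := by
        rw [intervalIntegral.integral_sub h1 intervalIntegrable_const,
          intervalIntegral.integral_const, sub_sub_cancel, smul_eq_mul]
    _ ≤ _ := by
        refine intervalIntegral.integral_mono_on (by linarith)
          (h1.sub intervalIntegrable_const) hi fun s hs => ?_
        have hs0 : 0 ≤ s := by linarith [hs.1]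
        have h3 : a ⬝ᵥ (∑ i, (S.C i s)ᵀ * S.C i s) *ᵥ a
            = ∑ i, (S.C i s *ᵥ a) ⬝ᵥ (S.C i s *ᵥ a) := by
          rw [sum_mulVec, dotProduct_sum]
          simp only [dotProduct_transpose_mul_mulVec]
        rw [h3]
        simp only [c, Finset.mul_sum]
        rw [← Finset.sum_sub_distrib]
        refine Finset.sum_le_sum fun i _ => ?_
        -- Expand the square of `C (a + β)`: the pure `β` term is nonnegative and dropped, the cross
        -- term costs at most `2 r₂ ‖a‖ ‖β‖`.
        rw [mulVec_add, add_dotProduct, dotProduct_add, dotProduct_add,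
          dotProduct_comm (S.C i s *ᵥ β i) (S.C i s *ᵥ a)]
        have h4 := (abs_le.1 (abs_dotProduct_mulVec_le ((S.C i s)ᵀ * S.C i s) a (β i))).1
        rw [dotProduct_transpose_mul_mulVec] at h4
        have h5 : ‖(S.C i s)ᵀ * S.C i s‖ * ‖WithLp.toLp 2 a‖ * ‖WithLp.toLp 2 (β i)‖
            ≤ K.r₂ * ‖WithLp.toLp 2 a‖ * ‖WithLp.toLp 2 (β i)‖ := by
          gcongr; exact hexc.regressor_le i s hs0
        have h6 : 0 ≤ (S.C i s *ᵥ β i) ⬝ᵥ (S.C i s *ᵥ β i) := dotProduct_self_nonneg _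
        linarith

/-- The Gramian under zero dynamics is bounded below by `ι₂`. -/
theorem ι₂lo_mul_le_integral (hexc : Excitation S K) (hn : 0 < n) {α : ℝ} (hα : 0 ≤ α) {t : ℝ}
    (ht : K.T ≤ t) (ξ : Fin n × Fin N → ℝ) :
    IntervalIntegrable (fun s => S.Lam α s *ᵥ ξ ⬝ᵥ S.Lam α s *ᵥ ξ) volume (t - K.T) t ∧
      K.ι₂lo n α * (ξ ⬝ᵥ ξ) ≤ ∫ s in t - K.T..t, S.Lam α s *ᵥ ξ ⬝ᵥ S.Lam α s *ᵥ ξ := by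
  have hT := hexc.T_pos
  have hn' : (0 : ℝ) < n := by exact_mod_cast hn
  -- Split the state into the network average `a` and the deviations `β`: consensus excites the
  -- deviations, the regressors excite the average.
  set a : Fin N → ℝ := fun l => (∑ i, ξ (i, l)) / n with ha
  set β : Fin n → Fin N → ℝ := fun i l => ξ (i, l) - a l with hβ
  have hrow : ∀ i, (fun l => ξ (i, l)) = a + β i := fun i => by funext l; simp [hβ]
  have hna : ∀ l, ∑ i, ξ (i, l) = n * a l := fun l => by rw [ha]; field_simp
  obtain ⟨hi1, hC⟩ := hexc.integral_regressor_ge ht a β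
  have hL := fun l => hexc.integral_laplacian_ge hn ht fun i => ξ (i, l)
  have hi2 : IntervalIntegrable
      (fun s => ∑ l, (fun i => ξ (i, l)) ⬝ᵥ S.L s *ᵥ fun i => ξ (i, l)) volume (t - K.T) t := by
    simpa only [Finset.sum_fn] using IntervalIntegrable.sum Finset.univ fun l _ => (hL l).1
  simp only [S.dotProduct_Lam_mulVec hα, hrow]
  refine ⟨hi1.add (hi2.const_mul α), ?_⟩
  rw [intervalIntegral.integral_add hi1 (hi2.const_mul α), intervalIntegral.integral_const_mul,
    intervalIntegral.integral_finsetSum fun l _ => (hL l).1]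
  have hsq : ξ ⬝ᵥ ξ = n * (a ⬝ᵥ a) + ∑ i, β i ⬝ᵥ β i := by
    have hterm : ∀ l, ∑ i, β i l * β i l = (∑ i, ξ (i, l) * ξ (i, l)) - n * (a l * a l) := by
      intro l
      have : ∀ i, β i l * β i l = ξ (i, l) * ξ (i, l) - 2 * a l * ξ (i, l) + a l * a l :=
        fun i => by simp only [hβ]; ring
      simp only [this, Finset.sum_add_distrib, Finset.sum_sub_distrib, ← Finset.mul_sum, hna]
      simp
      ring
    simp only [dotProduct, Fintype.sum_prod_type]
    rw [Finset.sum_comm, Finset.sum_comm (f := fun i l => β i l * β i l)]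
    simp only [hterm, Finset.sum_sub_distrib, Finset.mul_sum]
    ring
  have hLsum : K.lam * ∑ i, β i ⬝ᵥ β i
      ≤ ∑ l, ∫ s in t - K.T..t, (fun i => ξ (i, l)) ⬝ᵥ S.L s *ᵥ fun i => ξ (i, l) := by
    have h1 := Finset.sum_le_sum fun l (_ : l ∈ Finset.univ) => (hL l).2
    refine le_trans (le_of_eq ?_) h1
    rw [← Finset.mul_sum, Finset.sum_sub_distrib, ← dotProduct_self_eq_sum_cols, hsq]
    simp only [hna, dotProduct]
    have : ∀ l, (n * a l) ^ 2 / n = n * (a l * a l) := fun l => by field_simp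
    simp only [this, ← Finset.mul_sum]
    ring
  set b2 := ∑ i, β i ⬝ᵥ β i with hb2
  have hb0 : 0 ≤ b2 := Finset.sum_nonneg fun i _ => dotProduct_self_nonneg _
  have ha0 : 0 ≤ a ⬝ᵥ a := dotProduct_self_nonneg _
  have hCint : 0 ≤ ∫ s in t - K.T..t, ∑ i, (S.C i s *ᵥ (a + β i)) ⬝ᵥ (S.C i s *ᵥ (a + β i)) :=
    intervalIntegral.integral_nonneg (by linarith) fun s _ =>
      Finset.sum_nonneg fun i _ => dotProduct_self_nonneg _
  rcases (dotProduct_self_nonneg ξ).eq_or_lt with hz | hpos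
  · rw [← hz, mul_zero]
    exact add_nonneg hCint (mul_nonneg hα ((mul_nonneg hexc.lam_pos.le hb0).trans hLsum))
  set m := ξ ⬝ᵥ ξ with hm
  -- The minimum defining `ι₂` is tested at the `ρ` for which `ρ²` is the share of the average in
  -- `‖ξ‖²`. Whichever entry of the maximum dominates `ι₂` is supplied by the consensus or by the
  -- regressor part, the other part being nonnegative.
  have hρ2 : (√(n * (a ⬝ᵥ a) / m)) ^ 2 = n * (a ⬝ᵥ a) / m := Real.sq_sqrt (by positivity)
  have h1ρ : 1 - n * (a ⬝ᵥ a) / m = b2 / m := by rw [hsq] at hpos ⊢; field_simp; ring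
  have hle := Constants.ι₂lo_le (n := n) (K := K) hα hexc.lam_pos.le
    (ρ := √(n * (a ⬝ᵥ a) / m)) ⟨Real.sqrt_nonneg _, by
      refine Real.sqrt_le_iff.2 ⟨zero_le_one, ?_⟩
      rw [one_pow, div_le_one hpos, hsq]; linarith⟩
  rw [hρ2, h1ρ] at hle
  rcases le_max_iff.1 hle with h | h
  · have h2 := mul_le_mul_of_nonneg_right h hpos.le
    have h3 : α * K.lam * (b2 / m) * m = α * (K.lam * b2) := by field_simp
    have h4 := mul_le_mul_of_nonneg_left hLsum hα
    linarith
  · have h2 := mul_le_mul_of_nonneg_right h hpos.le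
    have hsqrt : √(n * (a ⬝ᵥ a) / m * (b2 / m)) * m = √(a ⬝ᵥ a) * (√n * √b2) := by
      have : n * (a ⬝ᵥ a) / m * (b2 / m) = (a ⬝ᵥ a) * (n * b2) / m ^ 2 := by field_simp
      rw [this, Real.sqrt_div (by positivity), Real.sqrt_sq hpos.le,
        div_mul_cancel₀ _ hpos.ne', Real.sqrt_mul ha0, Real.sqrt_mul hn'.le]
    -- Cauchy-Schwarz over the sensors; this `√n` pairs with `‖a‖` to give `√(ρ² (1 - ρ²))`.
    have hsumβ : ∑ i, ‖WithLp.toLp 2 (β i)‖ ≤ √n * √b2 := by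
      rw [← Real.sqrt_mul hn'.le]
      refine Real.le_sqrt_of_sq_le ?_
      refine (sq_sum_le_card_mul_sum_sq (s := Finset.univ)).trans ?_
      simp only [norm_toLp_sq_eq_dotProduct, Finset.card_univ, Fintype.card_fin]
      exact le_rfl
    have hna' : ‖WithLp.toLp 2 a‖ = √(a ⬝ᵥ a) := by
      rw [← norm_toLp_sq_eq_dotProduct, Real.sqrt_sq (norm_nonneg _)]
    rw [hna'] at hC
    have h3 : (K.ι₁lo / n * (n * (a ⬝ᵥ a) / m)
        - 2 * K.r₂ * K.T * √(n * (a ⬝ᵥ a) / m * (b2 / m))) * m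
        = K.ι₁lo * (a ⬝ᵥ a) - 2 * K.r₂ * K.T * (√(a ⬝ᵥ a) * (√n * √b2)) := by
      rw [sub_mul, mul_assoc (2 * K.r₂ * K.T), hsqrt]
      congr 1
      field_simp
    have h4 : 2 * K.r₂ * K.T * (√(a ⬝ᵥ a) * ∑ i, ‖WithLp.toLp 2 (β i)‖)
        ≤ 2 * K.r₂ * K.T * (√(a ⬝ᵥ a) * (√n * √b2)) := by
      have := hexc.r₂_pos
      gcongr
    have h5 := mul_nonneg hα ((mul_nonneg hexc.lam_pos.le hb0).trans hLsum)
    linarith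

/-- A unit vector on the first window lies between the lower bound of the Gramian and `T` times the
pointwise bound `r₄`. -/
theorem ι₂lo_le_ι₂hi (hexc : Excitation S K) (hn : 0 < n) (hN : 0 < N) {α : ℝ} (hα : 0 ≤ α) :
    K.ι₂lo n α ≤ K.ι₂hi α := by
  have hT := hexc.T_pos
  set ξ : Fin n × Fin N → ℝ := Pi.single (⟨0, hn⟩, ⟨0, hN⟩) 1 with hξ
  have h1 : ξ ⬝ᵥ ξ = 1 := by simp [hξ]
  obtain ⟨hi, h2⟩ := hexc.ι₂lo_mul_le_integral hn hα le_rfl ξ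
  rw [h1, mul_one] at h2
  refine h2.trans ?_
  calc _ ≤ ∫ _ in K.T - K.T..K.T, K.r₄ α := by
        refine intervalIntegral.integral_mono_on (by linarith) hi intervalIntegrable_const
          fun s hs => ?_
        simpa [h1] using hexc.Lam_mulVec_le hα (by linarith [hs.1] : (0 : ℝ) ≤ s) ξ
    _ = K.ι₂hi α := by simp [Constants.ι₂hi]

/-- Under excitation every sensor has at least one measurement. -/
theorem Ny_pos (hexc : Excitation S K) (hN : 0 < N) : 0 < Ny := by
  rcases Nat.eq_zero_or_pos Ny with rfl | h
  · exfalso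
    have h1 : matIntegral (fun s => ∑ i, (S.C i s)ᵀ * S.C i s) (K.T - K.T) K.T = 0 := by
      ext k l
      simp [matIntegral, Matrix.sum_apply]
    have h2 := (hexc.cpe_lower K.T le_rfl).dotProduct_mulVec_nonneg (Pi.single ⟨0, hN⟩ 1)
    rw [h1] at h2
    simp at h2
    linarith [hexc.ι₁lo_pos]
  · exact h

end Excitation
/-! ### Consequences of the tuning conditions -/

section Tuning

theorem dotProduct_φ₄₄_mulVec {R X : Type*} [Fintype R] [Fintype X] {r : ℕ} (D₁ : Matrix X (Fin r) ℝ) (D₂ : Matrix R (Fin r) ℝ)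
    (ιlo ιhi r₄ c₁ c₂ γ₁ γ : ℝ) (δ : Fin r → ℝ) :
    δ ⬝ᵥ φ₄₄ D₁ D₂ ιlo ιhi r₄ c₁ c₂ γ₁ γ *ᵥ δ
      = 8 * c₂ * ιhi ^ 2 / ιlo * (D₁ *ᵥ δ ⬝ᵥ D₁ *ᵥ δ)
        + (c₁ + 8 * c₂ * ιhi ^ 2 * r₄ * γ₁ / ιlo) * (D₂ *ᵥ δ ⬝ᵥ D₂ *ᵥ δ) - γ * (δ ⬝ᵥ δ) := by
  simp only [φ₄₄, sub_mulVec, add_mulVec, smul_mulVec, one_mulVec, dotProduct_sub, dotProduct_add,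
    dotProduct_smul, smul_eq_mul, dotProduct_transpose_mul_mulVec]

variable {R X : Type*} [Fintype R] [DecidableEq R] [Fintype X] [DecidableEq X] {r p : ℕ}
  {Q : Matrix (Fin p) X ℝ} {W : Matrix (Fin p) (Fin r) ℝ}

/-- The matrix inequality evaluated at vectors with vanishing state and performance output
`W δ`. -/
theorem lmi_at_disturbance (hW : Wᵀ * W = 1) {D₁ : Matrix X (Fin r) ℝ} {D₂ : Matrix R (Fin r) ℝ}
    {T ιlo ιhi r₄ c₂ c₁ γ₁ γ₂ γ : ℝ}
    (h : (-lmiMatrix Q W D₁ D₂ T ιlo ιhi r₄ c₂ c₁ γ₁ γ₂ γ).PosSemidef)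
    (u : R → ℝ) (δ : Fin r → ℝ) (η : X → ℝ) :
    (-c₁ + c₂ * T) * (u ⬝ᵥ u) + δ ⬝ᵥ δ + δ ⬝ᵥ φ₄₄ D₁ D₂ ιlo ιhi r₄ c₁ c₂ γ₁ γ *ᵥ δ
      - 2 * (2 * c₁ / √(c₂ * ιlo)) * (D₁ *ᵥ δ ⬝ᵥ η) - γ₂ * (η ⬝ᵥ η) ≤ 0 := by
  -- The entry `W δ` maximizes `2 ⟨ζ, W δ⟩ - ‖ζ‖²`; the maximum `‖δ‖²` is what later separates `γ -
  -- 1` from `γ`.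
  have h1 := h.dotProduct_mulVec_nonneg
    (Sum.elim (Sum.elim u (Sum.elim 0 (Sum.elim (W *ᵥ δ) δ))) η)
  rw [star_trivial, neg_mulVec, dotProduct_neg] at h1
  have hWδ : W *ᵥ δ ⬝ᵥ W *ᵥ δ = δ ⬝ᵥ δ := by
    rw [← dotProduct_transpose_mul_mulVec, hW, one_mulVec]
  have hWt : δ ⬝ᵥ Wᵀ *ᵥ (W *ᵥ δ) = δ ⬝ᵥ δ := by rw [mulVec_mulVec, hW, one_mulVec]
  have hD : δ ⬝ᵥ D₁ᵀ *ᵥ η = D₁ *ᵥ δ ⬝ᵥ η := by rw [dotProduct_mulVec, vecMul_transpose]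
  simp only [lmiMatrix, Φ₁₁, Φ₁₂, fromBlocks_mulVec, Sum.elim_comp_inl,
    Sum.elim_comp_inr, fromRows_mulVec, transpose_fromRows,
    fromCols_mulVec, sumElim_dotProduct_sumElim, transpose_zero, zero_mulVec, mulVec_zero,
    smul_mulVec, one_mulVec, neg_mulVec, dotProduct_add, dotProduct_smul, dotProduct_neg,
    zero_dotProduct, dotProduct_zero, add_zero, zero_add, smul_eq_mul, transpose_smul,
    transpose_transpose, hWδ, hWt, hD, dotProduct_comm η (D₁ *ᵥ δ)] at h1
  linarith

/-- Schur complement: the matrix is tested at `(ξ, Q ξ)`. -/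
theorem c₂Matrix_bounds {ιlo c₂ : ℝ} (h : (c₂Matrix Q ιlo c₂).PosDef) (ξ : X → ℝ) :
    Q *ᵥ ξ ⬝ᵥ Q *ᵥ ξ ≤ c₂ * ιlo / 2 * (ξ ⬝ᵥ ξ) := by
  have h1 := h.posSemidef.dotProduct_mulVec_nonneg (Sum.elim ξ (Q *ᵥ ξ))
  have hQ : ξ ⬝ᵥ Qᵀ *ᵥ (Q *ᵥ ξ) = Q *ᵥ ξ ⬝ᵥ Q *ᵥ ξ := by
    rw [mulVec_mulVec, dotProduct_transpose_mul_mulVec]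
  simp only [c₂Matrix, star_trivial, fromBlocks_mulVec, Sum.elim_comp_inl,
    Sum.elim_comp_inr, sumElim_dotProduct_sumElim,
    smul_mulVec, one_mulVec, neg_mulVec, dotProduct_add, dotProduct_smul, dotProduct_neg,
    smul_eq_mul, hQ] at h1
  linarith

/-- Read off a diagonal entry. The positivity of `ι₃`, and through it that of `ι₂`, is a consequence
of the choice of `c₂`, not a separate assumption. -/
theorem c₂Matrix_pos [Nonempty X] {ιlo c₂ : ℝ} (hc₂ : 0 < c₂) (h : (c₂Matrix Q ιlo c₂).PosDef) :
    0 < ιlo := by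
  have i : X := Classical.arbitrary X
  have h1 := h.diag_pos (i := Sum.inl i)
  simp [c₂Matrix] at h1
  exact (pos_iff_pos_of_mul_pos h1).1 hc₂

end Tuning

/-! ### The gain matrix and its inverse -/

section Gain

variable {X : Type*} [Fintype X] [DecidableEq X]

theorem blkDiag_posDef {n N : ℕ} {Γ : Fin n → Matrix (Fin N) (Fin N) ℝ} (hΓ : ∀ i, (Γ i).PosDef) :
    (blkDiag Γ).PosDef := by
  refine PosDef.of_dotProduct_mulVec_pos ?_ ?_
  · ext i j
    have h := (hΓ i.1).1.apply i.2 j.2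
    by_cases hij : i.1 = j.1
    · simp only [conjTranspose_apply, blkDiag, of_apply, hij, if_true] at h ⊢
      exact h
    · simp [blkDiag, hij, Ne.symm hij]
  · intro ξ hξ
    have hsum : ξ ⬝ᵥ blkDiag Γ *ᵥ ξ
        = ∑ i, (fun l => ξ (i, l)) ⬝ᵥ Γ i *ᵥ fun l => ξ (i, l) := by
      simp [mulVec, dotProduct, blkDiag, Fintype.sum_prod_type, ite_mul]
    rw [star_trivial, hsum]
    obtain ⟨⟨i, l⟩, hil⟩ := Function.ne_iff.1 hξ
    refine Finset.sum_pos' (fun j _ => ?_) ⟨i, Finset.mem_univ _, ?_⟩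
    · simpa using (hΓ j).posSemidef.dotProduct_mulVec_nonneg fun l => ξ (j, l)
    · have hne : (fun l => ξ (i, l)) ≠ 0 := fun h => hil (congrFun h l)
      simpa using (hΓ i).dotProduct_mulVec_pos hne

theorem inv_mulVec_mulVec_of_posDef {M : Matrix X X ℝ} (hM : M.PosDef) (ξ : X → ℝ) :
    M *ᵥ (M⁻¹ *ᵥ ξ) = ξ := by
  rw [mulVec_mulVec, mul_nonsing_inv _ (by exact (isUnit_iff_isUnit_det M).1 hM.isUnit), one_mulVec]

/-- `‖M η‖² ≤ R ⟨η, M η⟩` for a positive definite matrix of norm at most `R`. -/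
theorem mulVec_dotProduct_mulVec_le {M : Matrix X X ℝ} (hM : M.PosDef) {R : ℝ} (hR : 0 < R)
    (hMR : ‖M‖ ≤ R) (η : X → ℝ) : M *ᵥ η ⬝ᵥ M *ᵥ η ≤ R * (η ⬝ᵥ M *ᵥ η) := by
  have hMt : Mᵀ = M := by rw [← conjTranspose_eq_transpose_of_trivial]; exact hM.1
  -- Expanding gives `R² ⟨η, Mη⟩ - 2R ‖Mη‖² + ⟨Mη, M Mη⟩ ≥ 0`; the last term is at most `R ‖Mη‖²`,
  -- and one factor `R` cancels.
  have h0 := hM.posSemidef.dotProduct_mulVec_nonneg (R • η - M *ᵥ η)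
  have hsym : η ⬝ᵥ M *ᵥ (M *ᵥ η) = M *ᵥ η ⬝ᵥ M *ᵥ η := by
    rw [mulVec_mulVec]
    nth_rewrite 1 [← hMt]
    rw [dotProduct_transpose_mul_mulVec]
  have h1 : (M *ᵥ η) ⬝ᵥ M *ᵥ (M *ᵥ η) ≤ R * (M *ᵥ η ⬝ᵥ M *ᵥ η) := by
    refine (le_abs_self _).trans ((abs_dotProduct_mulVec_le M _ _).trans ?_)
    rw [mul_assoc, ← sq, norm_toLp_sq_eq_dotProduct]
    exact mul_le_mul_of_nonneg_right hMR (dotProduct_self_nonneg _)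
  simp only [star_trivial, mulVec_sub, mulVec_smul, sub_dotProduct, dotProduct_sub, smul_dotProduct,
    dotProduct_smul, smul_eq_mul, hsym] at h0
  nlinarith

/-- A lower bound of `M` bounds the inverse. -/
theorem mul_norm_inv_mulVec_le {M : Matrix X X ℝ} (hM : M.PosDef) {g : ℝ}
    (hg : (M - g • (1 : Matrix X X ℝ)).PosSemidef) (ξ : X → ℝ) :
    g * ‖WithLp.toLp 2 (M⁻¹ *ᵥ ξ)‖ ≤ ‖WithLp.toLp 2 ξ‖ := by
  set η := M⁻¹ *ᵥ ξ with hη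
  have hMη : M *ᵥ η = ξ := inv_mulVec_mulVec_of_posDef hM ξ
  have h := hg.dotProduct_mulVec_nonneg η
  rw [star_trivial, sub_mulVec, smul_mulVec, one_mulVec, dotProduct_sub, dotProduct_smul,
    smul_eq_mul, hMη, ← norm_toLp_sq_eq_dotProduct] at h
  have h1 := (abs_le.1 (abs_dotProduct_le η ξ)).2
  rcases (norm_nonneg (WithLp.toLp 2 η)).eq_or_lt with h0 | h0
  · rw [← h0, mul_zero]; exact norm_nonneg _
  · nlinarith

theorem le_norm_of_sub_posSemidef [Nonempty X] {M : Matrix X X ℝ} {g : ℝ}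
    (hg : (M - g • (1 : Matrix X X ℝ)).PosSemidef) : g ≤ ‖M‖ := by
  have i : X := Classical.arbitrary X
  have h := hg.diag_nonneg (i := i)
  simp at h
  exact h.trans ((le_abs_self _).trans (abs_entry_le_l2_opNorm M i i))

end Gain

/-! ### Padding the outputs to a time-independent index set -/

namespace SensorNetwork

variable {n Ny N : ℕ} (S : SensorNetwork n Ny N)

/-- A matrix whose rows are the stacked outputs at time `t`, extended by zero rows for the edges
that are absent at time `t`. -/
noncomputable def extendRows {J : Type*} {t : ℝ} (A : Matrix (S.OutIdx t) J ℝ) :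
    Matrix ((Fin n × Fin Ny) ⊕ ((Fin n × Fin n) × Fin N)) J ℝ :=
  Matrix.of fun k j => Sum.elim (fun k => A (Sum.inl k) j)
    (fun k => if h : k.1 ∈ (S.orient t).edges then A (Sum.inr (⟨k.1, h⟩, k.2)) j else 0) k

/-- Zero rows do not change products of columns. Hence padding preserves the dynamics and all norms,
while all outputs live in one Euclidean space, where measurability and `L₂` make sense. -/
theorem extendRows_transpose_mul {J J' : Type*} {t : ℝ} (A : Matrix (S.OutIdx t) J ℝ)
    (B : Matrix (S.OutIdx t) J' ℝ) :
    (S.extendRows A)ᵀ * S.extendRows B = Aᵀ * B := by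
  ext i j
  simp only [Matrix.mul_apply, transpose_apply, Fintype.sum_sum_type]
  congr 1
  refine (Fintype.sum_prod_type _).trans (Eq.trans ?_ (Fintype.sum_prod_type _).symm)
  rw [← Finset.sum_subset (Finset.subset_univ (S.orient t).edges), ← Finset.sum_coe_sort]
  · refine Finset.sum_congr rfl fun e _ => Finset.sum_congr rfl fun l _ => ?_
    simp [extendRows]
  · intro e _ he
    simp [extendRows, he]

theorem measurable_extendRows_Lam (α : ℝ) (k) (j : Fin n × Fin N) :
    Measurable fun t => S.extendRows (S.Lam α t) k j := by
  rcases k with ⟨i, m⟩ | ⟨e, l⟩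
  · simp only [extendRows, of_apply, Sum.elim_inl, Lam, fromRows_apply_inl, blkDiag]
    by_cases h : i = j.1
    · simpa [h] using S.measurable_C _ _ _
    · simp [h]
  · have h : ∀ t, S.extendRows (S.Lam α t) (Sum.inr (e, l)) j
        = if e ∈ (S.orient t).edges then √α * ((if j.1 = e.1 then 1 else if j.1 = e.2 then -1 else 0)
            * (1 : Matrix (Fin N) (Fin N) ℝ) l j.2) else 0 := by
      intro t
      by_cases he : e ∈ (S.orient t).edges
      · simp [extendRows, he, Lam, incidence, kroneckerMap_apply]
      · simp [extendRows, he]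
    simp only [h]
    exact Measurable.ite (S.measurableSet_edge e.1 e.2) measurable_const measurable_const

variable {S} in
theorem OutDisturbance.IsMeasurable.extendRows {r : ℕ} {Δ₂ : S.OutDisturbance r}
    (hΔ₂ : Δ₂.IsMeasurable) (k) (j : Fin r) : Measurable fun t => S.extendRows (Δ₂ t) k j := by
  rcases k with k | ⟨e, l⟩
  · exact hΔ₂.meas k j
  · convert hΔ₂.edge e l j using 2 with t
    by_cases he : e ∈ (S.orient t).edges <;> simp [SensorNetwork.extendRows, he]

end SensorNetwork

theorem aestronglyMeasurable_toEuclideanLin {κ ι : Type*} [Fintype κ] [Fintype ι]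
    [DecidableEq ι] {A : ℝ → Matrix κ ι ℝ} (hA : ∀ k j, Measurable fun t => A t k j)
    {u : ℝ → EuclideanSpace ℝ ι} {μ : Measure ℝ} (hu : AEStronglyMeasurable u μ) :
    AEStronglyMeasurable (fun t => Matrix.toEuclideanLin (A t) (u t)) μ := by
  have h1 : AEMeasurable (fun t => A t *ᵥ (u t).ofLp) μ := by
    refine aemeasurable_pi_lambda _ fun k => ?_
    simp only [mulVec, dotProduct]
    refine Finset.aemeasurable_fun_sum _ fun j _ => (hA k j).aemeasurable.mul ?_
    exact ((EuclideanSpace.proj (𝕜 := ℝ) j).continuous.comp_aestronglyMeasurable hu).aemeasurable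
  exact (EuclideanSpace.equiv κ ℝ).symm.continuous.comp_aestronglyMeasurable
    h1.aestronglyMeasurable

/-! ### Testing the matrix inequality -/

section PointwiseBounds

variable {R X : Type*} [Fintype R] [DecidableEq R] [Fintype X] [DecidableEq X] {r p : ℕ}
  {Q : Matrix (Fin p) X ℝ} {W : Matrix (Fin p) (Fin r) ℝ}
  {D₁ : Matrix X (Fin r) ℝ} {D₂ : Matrix R (Fin r) ℝ}
  {T ιlo ιhi r₄ c₂ c₁ γ₁ γ₂ γ : ℝ}

theorem mul_le_of_lmi [Nonempty R] (hW : Wᵀ * W = 1)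
    (h : (-lmiMatrix Q W D₁ D₂ T ιlo ιhi r₄ c₂ c₁ γ₁ γ₂ γ).PosSemidef) : c₂ * T ≤ c₁ := by
  have h1 := lmi_at_disturbance hW h (Pi.single (Classical.arbitrary R) 1) 0 0
  simp at h1
  linarith

theorem nonneg_of_lmi [Nonempty X] (hW : Wᵀ * W = 1)
    (h : (-lmiMatrix Q W D₁ D₂ T ιlo ιhi r₄ c₂ c₁ γ₁ γ₂ γ).PosSemidef) : 0 ≤ γ₂ := by
  have h1 := lmi_at_disturbance hW h 0 0 (Pi.single (Classical.arbitrary X) 1)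
  simpa using h1

/-- The terms of `φ₄₄` containing `ῑ₃` are nonnegative and can be discarded; the weight `c₁` of the
output disturbance suffices. -/
theorem disturbance_bound_of_lmi (hW : Wᵀ * W = 1) (hc₂ : 0 < c₂) (hιlo : 0 < ιlo)
    (hr₄ : 0 ≤ r₄) (hγ₂ : 0 ≤ γ₂) (hγ₁ : γ₂ ≤ γ₁)
    (h : (-lmiMatrix Q W D₁ D₂ T ιlo ιhi r₄ c₂ c₁ γ₁ γ₂ γ).PosSemidef) (δ : Fin r → ℝ)
    (η : X → ℝ) :
    δ ⬝ᵥ δ + c₁ * (D₂ *ᵥ δ ⬝ᵥ D₂ *ᵥ δ) - 2 * (2 * c₁ / √(c₂ * ιlo)) * (D₁ *ᵥ δ ⬝ᵥ η)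
      - γ₂ * (η ⬝ᵥ η) ≤ γ * (δ ⬝ᵥ δ) := by
  have h1 := lmi_at_disturbance hW h 0 δ η
  rw [dotProduct_φ₄₄_mulVec, zero_dotProduct, mul_zero, zero_add, add_mul] at h1
  have hγ₁0 : 0 ≤ γ₁ := hγ₂.trans hγ₁
  have h2 : 0 ≤ 8 * c₂ * ιhi ^ 2 / ιlo * (D₁ *ᵥ δ ⬝ᵥ D₁ *ᵥ δ) :=
    mul_nonneg (by positivity) (dotProduct_self_nonneg _)
  have h3 : 0 ≤ 8 * c₂ * ιhi ^ 2 * r₄ * γ₁ / ιlo * (D₂ *ᵥ δ ⬝ᵥ D₂ *ᵥ δ) :=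
    mul_nonneg (by positivity) (dotProduct_self_nonneg _)
  linarith

/-- Schur complement of the matrix inequality; for `γ₂ = 0` the quotient is `0`. -/
theorem disturbance_energy_of_lmi (hW : Wᵀ * W = 1) (hc₂ : 0 < c₂)
    (hιlo : 0 < ιlo) (hr₄ : 0 ≤ r₄) (hγ₂ : 0 ≤ γ₂) (hγ₁ : γ₂ ≤ γ₁)
    (h : (-lmiMatrix Q W D₁ D₂ T ιlo ιhi r₄ c₂ c₁ γ₁ γ₂ γ).PosSemidef) (δ : Fin r → ℝ) :
    c₁ * (D₂ *ᵥ δ ⬝ᵥ D₂ *ᵥ δ) + 4 * c₁ ^ 2 / (c₂ * ιlo) * ((D₁ *ᵥ δ ⬝ᵥ D₁ *ᵥ δ) / γ₂)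
      ≤ (γ - 1) * (δ ⬝ᵥ δ) := by
  -- The maximizer over `η`, for `k = 2 c₁ / √(c₂ ι₃)`, is `η = -(k / γ₂) D₁ δ`. For `γ₂ = 0`
  -- division by zero makes this vector zero, which is a valid test as well.
  have h1 := disturbance_bound_of_lmi hW hc₂ hιlo hr₄ hγ₂ hγ₁ h δ
    (-(2 * c₁ / √(c₂ * ιlo) / γ₂) • D₁ *ᵥ δ)
  have hk : (2 * c₁ / √(c₂ * ιlo)) ^ 2 = 4 * c₁ ^ 2 / (c₂ * ιlo) := by
    rw [div_pow, Real.sq_sqrt (by positivity)]; ring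
  rw [← hk]
  set k := 2 * c₁ / √(c₂ * ιlo)
  simp only [dotProduct_smul, smul_dotProduct, smul_eq_mul] at h1
  rcases hγ₂.eq_or_lt with h0 | h0
  · rw [← h0] at h1 ⊢
    simp only [div_zero, neg_zero, zero_mul, mul_zero, sub_zero, add_zero] at h1 ⊢
    linarith
  · have h2 : 2 * k * (-(k / γ₂) * (D₁ *ᵥ δ ⬝ᵥ D₁ *ᵥ δ))
        + γ₂ * (-(k / γ₂) * (-(k / γ₂) * (D₁ *ᵥ δ ⬝ᵥ D₁ *ᵥ δ)))
        = -(k ^ 2 * ((D₁ *ᵥ δ ⬝ᵥ D₁ *ᵥ δ) / γ₂)) := by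
      field_simp; ring
    linarith

/-- Without the quadratic term in `η` the bound is affine in `η`, so it can hold for all `η` only if
the linear coefficient `D₁ δ` vanishes. -/
theorem drift_eq_zero_of_lmi (hW : Wᵀ * W = 1) (hc₁ : 0 < c₁) (hc₂ : 0 < c₂)
    (hιlo : 0 < ιlo) (hr₄ : 0 ≤ r₄) (hγ₂ : γ₂ = 0) (hγ₁ : γ₂ ≤ γ₁)
    (h : (-lmiMatrix Q W D₁ D₂ T ιlo ιhi r₄ c₂ c₁ γ₁ γ₂ γ).PosSemidef) (δ : Fin r → ℝ) :
    D₁ *ᵥ δ = 0 := by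
  have h1 := fun s : ℝ => disturbance_bound_of_lmi hW hc₂ hιlo hr₄ hγ₂.ge hγ₁ h δ
    (-s • D₁ *ᵥ δ)
  simp only [hγ₂, zero_mul, sub_zero, dotProduct_smul, smul_eq_mul] at h1
  have hk : 0 < 2 * c₁ / √(c₂ * ιlo) := by positivity
  have hD := dotProduct_self_nonneg (D₂ *ᵥ δ)
  set k := 2 * c₁ / √(c₂ * ιlo)
  by_contra hne
  have hpos : 0 < D₁ *ᵥ δ ⬝ᵥ D₁ *ᵥ δ :=
    (dotProduct_self_nonneg _).lt_of_ne fun h => hne (dotProduct_self_eq_zero.1 h.symm)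
  -- This multiple makes the linear term exceed the available `γ ‖δ‖² - ‖δ‖²` by exactly `1`.
  have h2 := h1 ((γ * (δ ⬝ᵥ δ) - δ ⬝ᵥ δ + 1) / (2 * k * (D₁ *ᵥ δ ⬝ᵥ D₁ *ᵥ δ)))
  have h3 : 2 * k * (-((γ * (δ ⬝ᵥ δ) - δ ⬝ᵥ δ + 1) / (2 * k * (D₁ *ᵥ δ ⬝ᵥ D₁ *ᵥ δ)))
      * (D₁ *ᵥ δ ⬝ᵥ D₁ *ᵥ δ)) = -(γ * (δ ⬝ᵥ δ) - δ ⬝ᵥ δ + 1) := by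
    field_simp
  rw [h3] at h2
  linarith [mul_nonneg hc₁.le hD]

end PointwiseBounds

/-! ### From trajectories to the gain bound -/

theorem inner_toEuclideanLin_left {κ ι : Type*} [Fintype κ] [Fintype ι] [DecidableEq ι]
    (A : Matrix κ ι ℝ) (ξ : EuclideanSpace ℝ ι) (η : EuclideanSpace ℝ κ) :
    inner ℝ (Matrix.toEuclideanLin A ξ) η = A *ᵥ ξ.ofLp ⬝ᵥ η.ofLp := by
  rw [EuclideanSpace.inner_eq_star_dotProduct, star_trivial, dotProduct_comm]
  rfl

theorem norm_toEuclideanLin_sq {κ ι : Type*} [Fintype κ] [Fintype ι] [DecidableEq ι]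
    (A : Matrix κ ι ℝ) (ξ : EuclideanSpace ℝ ι) :
    ‖Matrix.toEuclideanLin A ξ‖ ^ 2 = A *ᵥ ξ.ofLp ⬝ᵥ A *ᵥ ξ.ofLp :=
  norm_toLp_sq_eq_dotProduct _

variable {n Ny N r p : ℕ}

/-- The numerical comparison between the excitation bound `ι₃` and the constants of the `L₂`
estimate. -/
theorem gain_constants_le {T ι₂ ι₂' ι₃ a c₁ c₂ : ℝ} (hT : 0 < T) (hι₂ : 0 < ι₂) (hle : ι₂ ≤ ι₂')
    (hι₃ : 0 < ι₃) (ha : 0 ≤ a) (hι : ι₃ * (1 + a) ^ 2 ≤ ι₂) (hc₂ : 0 < c₂) (hc : c₂ * T ≤ c₁) :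
    c₂ * ι₃ / 2 * (2 * (T * ((1 + a) ^ 2 / ι₂))) ≤ c₁ ∧
      c₂ * ι₃ / 2 * (4 * (T * ((1 + a) ^ 2 / ι₂)) ^ 2
        + 2 * (T * ((1 + a) ^ 2 * a / (ι₂' / T) / ι₂))) ≤ 4 * c₁ ^ 2 / (c₂ * ι₃) := by
  have hA : (1 + a) ^ 2 / ι₂ ≤ 1 / ι₃ := by
    rw [div_le_div_iff₀ hι₂ hι₃]; linarith
  -- The crude bounds `a ≤ (1 + a) ^ 2` and `ι₂ ≤ ι₂'` are affordable: the sum below needs the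
  -- factor `3`, and the matrix inequality offers `4`.
  have hB : (1 + a) ^ 2 * a / (ι₂' / T) / ι₂ ≤ T * (1 / ι₃) ^ 2 := by
    calc (1 + a) ^ 2 * a / (ι₂' / T) / ι₂ ≤ (1 + a) ^ 2 * (1 + a) ^ 2 / (ι₂ / T) / ι₂ := by
          gcongr
          nlinarith
      _ = T * ((1 + a) ^ 2 / ι₂) ^ 2 := by field_simp
      _ ≤ T * (1 / ι₃) ^ 2 := by gcongr
  have hc₁ : 0 < c₁ := lt_of_lt_of_le (by positivity) hc
  constructor
  · calc c₂ * ι₃ / 2 * (2 * (T * ((1 + a) ^ 2 / ι₂))) ≤ c₂ * ι₃ / 2 * (2 * (T * (1 / ι₃))) := by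
          gcongr
      _ = c₂ * T := by field_simp
      _ ≤ c₁ := hc
  · calc _ ≤ c₂ * ι₃ / 2 * (4 * (T * (1 / ι₃)) ^ 2 + 2 * (T * (T * (1 / ι₃) ^ 2))) := by gcongr
      _ = 3 * (c₂ * T) ^ 2 / (c₂ * ι₃) := by field_simp; ring
      _ ≤ 4 * c₁ ^ 2 / (c₂ * ι₃) := by
          gcongr
          norm_num

/-- Brings the dynamics, on padded outputs, into the form `-Γ Λᵀ (Λ x - w) - d` required by
`integral_norm_sq_le_of_excitation`. -/
theorem errRhs_eq (S : SensorNetwork n Ny N) (α : ℝ) (Γ : Fin n → Matrix (Fin N) (Fin N) ℝ)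
    (Δ₁ : Matrix (Fin N) (Fin r) ℝ) (Δ₂ : S.OutDisturbance r) (t : ℝ)
    (x : EuclideanSpace ℝ (Fin n × Fin N)) (δ : EuclideanSpace ℝ (Fin r)) :
    errRhs S α Γ Δ₁ Δ₂ t x δ = -Matrix.toEuclideanLin (blkDiag Γ)
      (Matrix.toEuclideanLin (S.extendRows (S.Lam α t))ᵀ
        (Matrix.toEuclideanLin (S.extendRows (S.Lam α t)) x
          - Matrix.toEuclideanLin (S.extendRows (Δ₂ t)) δ))
      - Matrix.toEuclideanLin (stackOnes n Δ₁) δ := by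
  apply (WithLp.ofLp_injective 2)
  simp only [errRhs, map_sub, WithLp.ofLp_add, WithLp.ofLp_sub, WithLp.ofLp_neg,
    Matrix.ofLp_toLpLin, Matrix.toLin'_apply, mulVec_mulVec, S.extendRows_transpose_mul,
    Matrix.mul_assoc, LinearMap.sub_apply]
  abel

theorem inner_inv_toEuclideanLin {X : Type*} [Fintype X] [DecidableEq X] {M : Matrix X X ℝ}
    (hM : M.PosDef) (ξ η : EuclideanSpace ℝ X) :
    inner ℝ (Matrix.toEuclideanLin M⁻¹ ξ) (Matrix.toEuclideanLin M η) = inner ℝ ξ η := by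
  have hMt : Mᵀ = M := by rw [← conjTranspose_eq_transpose_of_trivial]; exact hM.1
  have hMit : (M⁻¹)ᵀ = M⁻¹ := by rw [transpose_nonsing_inv, hMt]
  rw [inner_toEuclideanLin_left, Matrix.ofLp_toLpLin, Matrix.toLin'_apply,
    ← dotProduct_transpose_mul_mulVec, hMit,
    nonsing_inv_mul _ ((isUnit_iff_isUnit_det M).1 hM.isUnit), one_mulVec,
    EuclideanSpace.inner_eq_star_dotProduct, star_trivial, dotProduct_comm]

theorem norm_sq_le_mul_inner_inv {X : Type*} [Fintype X] [DecidableEq X] {M : Matrix X X ℝ}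
    (hM : M.PosDef) {R : ℝ} (hR : 0 < R) (hMR : ‖M‖ ≤ R) (ξ : EuclideanSpace ℝ X) :
    ‖ξ‖ ^ 2 ≤ R * inner ℝ (Matrix.toEuclideanLin M⁻¹ ξ) ξ := by
  have h := mulVec_dotProduct_mulVec_le hM hR hMR (M⁻¹ *ᵥ ξ.ofLp)
  rw [inv_mulVec_mulVec_of_posDef hM] at h
  rw [inner_toEuclideanLin_left]
  exact (norm_toLp_sq_eq_dotProduct ξ.ofLp).trans_le h

theorem norm_extendRows_sq (S : SensorNetwork n Ny N) {J : Type*} [Fintype J] [DecidableEq J]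
    {t : ℝ} (A : Matrix (S.OutIdx t) J ℝ) (ξ : EuclideanSpace ℝ J) :
    ‖Matrix.toEuclideanLin (S.extendRows A) ξ‖ ^ 2 = A *ᵥ ξ.ofLp ⬝ᵥ A *ᵥ ξ.ofLp := by
  rw [norm_toEuclideanLin_sq, ← dotProduct_transpose_mul_mulVec, S.extendRows_transpose_mul,
    dotProduct_transpose_mul_mulVec]

/-- `L₂` estimate for the state along a trajectory, in terms of the energies of the output
disturbance `Δ̄₂ δ` and of the drift `Δ̄₁ δ`. -/
theorem IsTrajectory.integral_norm_sq_le (hn : 0 < n)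
    {S : SensorNetwork n Ny N} {K : Constants} (hexc : Excitation S K)
    {Δ₁ : Matrix (Fin N) (Fin r) ℝ} {Δ₂ : S.OutDisturbance r}
    {r₁ : ℝ} (hr₁ : 0 < r₁) {α : ℝ} (hα : 0 < α) (hι₂ : 0 < K.ι₂lo n α) {g : ℝ}
    {Γ : Fin n → Matrix (Fin N) (Fin N) ℝ} (hM : (blkDiag Γ).PosDef) (hMr₁ : ‖blkDiag Γ‖ ≤ r₁)
    (hMg : (blkDiag Γ - g • (1 : Matrix (Fin n × Fin N) (Fin n × Fin N) ℝ)).PosSemidef)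
    (hgr₁ : g ≤ r₁)
    {x₀ : EuclideanSpace ℝ (Fin n × Fin N)} {δ : ℝ → EuclideanSpace ℝ (Fin r)}
    {x : ℝ → EuclideanSpace ℝ (Fin n × Fin N)} (hx : IsTrajectory S α Γ Δ₁ Δ₂ x₀ δ x)
    (hw : MemLp (fun s => Matrix.toEuclideanLin (S.extendRows (Δ₂ s)) (δ s)) 2
      (volume.restrict (Set.Ioi 0)))
    {f : ℝ → ℝ} (hf0 : ∀ s, 0 ≤ f s) (hf : MemLp f 2 (volume.restrict (Set.Ioi 0)))
    (hfd : ∀ s, ‖Matrix.toEuclideanLin (stackOnes n Δ₁) (δ s)‖ = g * f s) :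
    ContinuousOn x (Set.Ici 0) ∧ IntegrableOn (fun s => ‖x s‖ ^ 2) (Set.Ioi 0) ∧
      ∫ s in Set.Ioi 0, ‖x s‖ ^ 2
        ≤ 2 * (K.T * ((1 + √(K.φ₁ r₁ α)) ^ 2 / K.ι₂lo n α)) *
            (inner ℝ (Matrix.toEuclideanLin (blkDiag Γ)⁻¹ x₀) x₀ + ∫ s in Set.Ioi 0,
              ‖Matrix.toEuclideanLin (S.extendRows (Δ₂ s)) (δ s)‖ ^ 2)
        + (4 * (K.T * ((1 + √(K.φ₁ r₁ α)) ^ 2 / K.ι₂lo n α)) ^ 2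
          + 2 * (K.T * ((1 + √(K.φ₁ r₁ α)) ^ 2 * √(K.φ₁ r₁ α) / √(K.r₄ α) ^ 2 / K.ι₂lo n α)))
          * ∫ s in Set.Ioi 0, f s ^ 2 := by
  have hT := hexc.T_pos
  have hr₄ : 0 < K.r₄ α := add_pos hexc.r₂_pos (mul_pos hα hexc.r₃_pos)
  have hφ : 0 < K.φ₁ r₁ α := by
    have : 0 < K.ι₂hi α := mul_pos hT hr₄
    unfold Constants.φ₁
    positivity
  have hρ2 : √(K.r₄ α) ^ 2 = K.r₄ α := Real.sq_sqrt hr₄.le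
  have hgram : ∀ t, 0 ≤ t → ∀ ξ : EuclideanSpace ℝ (Fin n × Fin N),
      IntervalIntegrable (fun s => ‖Matrix.toEuclideanLin (S.extendRows (S.Lam α s)) ξ‖ ^ 2)
        volume t (t + K.T) ∧ K.ι₂lo n α * ‖ξ‖ ^ 2
        ≤ ∫ s in t..t + K.T, ‖Matrix.toEuclideanLin (S.extendRows (S.Lam α s)) ξ‖ ^ 2 := by
    intro t ht ξ
    have h := hexc.ι₂lo_mul_le_integral hn hα.le (by linarith : K.T ≤ t + K.T) ξ.ofLp
    simp only [norm_extendRows_sq]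
    rw [add_sub_cancel_right, ← norm_toLp_sq_eq_dotProduct] at h
    exact h
  simp only [IsTrajectory, errRhs_eq] at hx
  refine integral_norm_sq_le_of_excitation
    (Λ := fun s => Matrix.toEuclideanLin (S.extendRows (S.Lam α s)))
    (Λa := fun s => Matrix.toEuclideanLin (S.extendRows (S.Lam α s))ᵀ)
    (Γ := Matrix.toEuclideanLin (blkDiag Γ)) (P := Matrix.toEuclideanLin (blkDiag Γ)⁻¹)
    (d := fun s => Matrix.toEuclideanLin (stackOnes n Δ₁) (δ s)) hT hr₁ (Real.sqrt_pos.2 hr₄) hι₂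
    (Real.sqrt_pos.2 hφ) ?_ hf0 ?_ (Matrix.isSymmetric_toEuclideanLin_iff.2 hM.inv.1)
    (inner_inv_toEuclideanLin hM) ?_ (norm_sq_le_mul_inner_inv hM hr₁ hMr₁) ?_ ?_
    (fun t ht => (hx t ht).1) (fun t ht => (hx t ht).2) ?_ (fun t ht ξ => (hgram t ht ξ).2)
    (fun t ht ξ => (hgram t ht ξ).1) ?_ hw hf
  -- The definition of `φ₁` is exactly the equation for `a ^ 2`, with `R = r₁` and `ρ² = r₄`.
  · rw [Real.sq_sqrt hφ.le, hρ2, Constants.φ₁, Constants.ι₂hi]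
    ring
  · intro s η ξ
    rw [inner_toEuclideanLin_left, EuclideanSpace.inner_eq_star_dotProduct, star_trivial,
      dotProduct_comm, dotProduct_mulVec, vecMul_transpose]
    rfl
  · intro ξ
    exact (norm_toLp_mulVec_le (blkDiag Γ) ξ.ofLp).trans
      (mul_le_mul_of_nonneg_right hMr₁ (norm_nonneg _))
  · intro s _ ξ
    refine (abs_real_inner_le_norm _ _).trans ?_
    rw [hfd, ← mul_assoc]
    refine mul_le_mul_of_nonneg_right ?_ (hf0 s)
    rw [mul_comm]
    exact mul_norm_inv_mulVec_le hM hMg ξ.ofLp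
  · intro s _
    rw [hfd]
    exact mul_le_mul_of_nonneg_right hgr₁ (hf0 s)
  · intro s hs ξ
    refine (abs_le_of_sq_le_sq' ?_ (by positivity)).2
    rw [norm_extendRows_sq, mul_pow, hρ2]
    refine (hexc.Lam_mulVec_le hα.le hs ξ.ofLp).trans_eq ?_
    rw [← norm_toLp_sq_eq_dotProduct]
  · exact fun hxc => aestronglyMeasurable_toEuclideanLin (S.measurable_extendRows_Lam α)
      ((hxc.mono Set.Ioi_subset_Ici_self).aestronglyMeasurable measurableSet_Ioi)

/-- A measurable function whose square is dominated by a multiple of an integrable function. -/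
theorem memLp_two_of_mul_sq_le {E : Type*} [NormedAddCommGroup E] {u : ℝ → E} {q : ℝ → ℝ} {k : ℝ}
    (hk : 0 < k) (hu : AEStronglyMeasurable u (volume.restrict (Set.Ioi 0)))
    (hq : Integrable q (volume.restrict (Set.Ioi 0)))
    (h : ∀ s, 0 ≤ s → k * ‖u s‖ ^ 2 ≤ q s) : MemLp u 2 (volume.restrict (Set.Ioi 0)) := by
  refine (memLp_two_iff_integrable_sq_norm hu).2
    ((hq.const_mul (1 / k)).mono' (hu.norm.pow 2) ?_)
  refine (ae_restrict_iff' measurableSet_Ioi).2 (Filter.Eventually.of_forall fun s hs => ?_)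
  rw [Real.norm_of_nonneg (sq_nonneg _), div_mul_eq_mul_div, one_mul, le_div_iff₀ hk, mul_comm]
  exact h s (le_of_lt hs)

/-- The output disturbance and the drift, measured relative to the gain, are square integrable,
and their weighted energy is controlled by the matrix inequality. -/
theorem SDPFeasible.disturbance_energy_le (hn : 0 < n) (hN : 0 < N) {S : SensorNetwork n Ny N}
    {K : Constants} (hNy : 0 < Ny) (hT : 0 < K.T)
    {Δ₁ : Matrix (Fin N) (Fin r) ℝ} {Δ₂ : S.OutDisturbance r} (hΔ₂ : Δ₂.IsMeasurable)
    {Q : Matrix (Fin p) (Fin n × Fin N) ℝ} {W : Matrix (Fin p) (Fin r) ℝ} (hW : Wᵀ * W = 1)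
    {r₁ α c₂ c₁ γ₁ γ₂ γ : ℝ} (hr₄ : 0 ≤ K.r₄ α) (hι₃ : 0 < K.ι₃lo n r₁ α) (hc₂ : 0 < c₂)
    (hsdp : SDPFeasible S K Δ₁ Δ₂ Q W r₁ α c₂ c₁ γ₁ γ₂ γ)
    {δ : ℝ → EuclideanSpace ℝ (Fin r)} (hδ : MemLp δ 2 (volume.restrict (Set.Ioi 0))) :
    c₂ * K.T ≤ c₁ ∧ MemLp (fun s => Matrix.toEuclideanLin (S.extendRows (Δ₂ s)) (δ s)) 2
      (volume.restrict (Set.Ioi 0)) ∧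
    ∃ f : ℝ → ℝ, (∀ s, 0 ≤ f s) ∧ MemLp f 2 (volume.restrict (Set.Ioi 0)) ∧
      (∀ s, ‖Matrix.toEuclideanLin (stackOnes n Δ₁) (δ s)‖ = √γ₂ * f s) ∧
      c₁ * (∫ s in Set.Ioi 0, ‖Matrix.toEuclideanLin (S.extendRows (Δ₂ s)) (δ s)‖ ^ 2)
        + 4 * c₁ ^ 2 / (c₂ * K.ι₃lo n r₁ α) * (∫ s in Set.Ioi 0, f s ^ 2)
        ≤ (γ - 1) * ∫ s in Set.Ioi 0, ‖δ s‖ ^ 2 := by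
  have : Nonempty (Fin n × Fin N) := ⟨(⟨0, hn⟩, ⟨0, hN⟩)⟩
  have : ∀ t, Nonempty (S.OutIdx t) := fun t => ⟨Sum.inl (⟨0, hn⟩, ⟨0, hNy⟩)⟩
  have hlmi := hsdp.lmi
  have hγ₁ : γ₂ ≤ γ₁ := sub_nonneg.1 hsdp.γ₂_le
  have hcT : c₂ * K.T ≤ c₁ := mul_le_of_lmi hW (hlmi 0 le_rfl)
  have hγ₂ : 0 ≤ γ₂ := nonneg_of_lmi hW (hlmi 0 le_rfl)
  have hc₁ : 0 < c₁ := lt_of_lt_of_le (by positivity) hcT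
  have hk : 0 < 4 * c₁ ^ 2 / (c₂ * K.ι₃lo n r₁ α) := by positivity
  set f : ℝ → ℝ := fun s => ‖Matrix.toEuclideanLin (stackOnes n Δ₁) (δ s)‖ / √γ₂ with hf_def
  have hf2 : ∀ s, f s ^ 2
      = (stackOnes n Δ₁ *ᵥ (δ s).ofLp ⬝ᵥ stackOnes n Δ₁ *ᵥ (δ s).ofLp) / γ₂ := fun s => by
    rw [hf_def, div_pow, Real.sq_sqrt hγ₂, norm_toEuclideanLin_sq]
  have hpoint : ∀ s, 0 ≤ s → c₁ * ‖Matrix.toEuclideanLin (S.extendRows (Δ₂ s)) (δ s)‖ ^ 2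
      + 4 * c₁ ^ 2 / (c₂ * K.ι₃lo n r₁ α) * f s ^ 2 ≤ (γ - 1) * ‖δ s‖ ^ 2 := fun s hs => by
    have h := disturbance_energy_of_lmi hW hc₂ hι₃ hr₄ hγ₂ hγ₁ (hlmi s hs) (δ s).ofLp
    rw [← norm_extendRows_sq S (Δ₂ s) (δ s), ← hf2, ← norm_toLp_sq_eq_dotProduct] at h
    exact h
  have hfd : ∀ s, ‖Matrix.toEuclideanLin (stackOnes n Δ₁) (δ s)‖ = √γ₂ * f s := by
    intro s
    -- For `γ₂ = 0` the quotient `f` is zero by convention; the identity survives because the matrix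
    -- inequality then forces the drift to vanish.
    rcases eq_or_ne (√γ₂) 0 with h0 | h0
    · have h := drift_eq_zero_of_lmi hW hc₁ hc₂ hι₃ hr₄ ((Real.sqrt_eq_zero hγ₂).1 h0) hγ₁
        (hlmi 0 le_rfl) (δ s).ofLp
      have h' : Matrix.toEuclideanLin (stackOnes n Δ₁) (δ s) = 0 := congrArg (WithLp.toLp 2) h
      rw [h', h0, norm_zero, zero_mul]
    · rw [hf_def, mul_div_cancel₀ _ h0]
  have hf0 : ∀ s, 0 ≤ f s := fun s => div_nonneg (norm_nonneg _) (Real.sqrt_nonneg _)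
  have hδ2 : Integrable (fun s => (γ - 1) * ‖δ s‖ ^ 2) (volume.restrict (Set.Ioi 0)) :=
    hδ.norm.integrable_sq.const_mul _
  have hfm : AEStronglyMeasurable f (volume.restrict (Set.Ioi 0)) := by
    have hdm : AEStronglyMeasurable
        (fun s => Matrix.toEuclideanLin (stackOnes n Δ₁) (δ s)) (volume.restrict (Set.Ioi 0)) :=
      (LinearMap.toContinuousLinearMap
        (Matrix.toEuclideanLin (stackOnes n Δ₁))).continuous.comp_aestronglyMeasurable hδ.1
    rw [hf_def]
    simp only [div_eq_mul_inv]
    exact hdm.norm.mul_const _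
  have hwm : AEStronglyMeasurable (fun s => Matrix.toEuclideanLin (S.extendRows (Δ₂ s)) (δ s))
      (volume.restrict (Set.Ioi 0)) :=
    aestronglyMeasurable_toEuclideanLin (fun k j => hΔ₂.extendRows k j) hδ.1
  have hwL : MemLp (fun s => Matrix.toEuclideanLin (S.extendRows (Δ₂ s)) (δ s)) 2
      (volume.restrict (Set.Ioi 0)) := by
    refine memLp_two_of_mul_sq_le hc₁ hwm hδ2 fun s hs => ?_
    have h2 := mul_nonneg hk.le (sq_nonneg (f s))
    exact le_trans (le_add_of_nonneg_right h2) (hpoint s hs)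
  have hfL : MemLp f 2 (volume.restrict (Set.Ioi 0)) :=
    memLp_two_of_mul_sq_le hk hfm hδ2 fun s hs => by
      have h2 := mul_nonneg hc₁.le
        (sq_nonneg ‖Matrix.toEuclideanLin (S.extendRows (Δ₂ s)) (δ s)‖)
      rw [Real.norm_eq_abs, sq_abs]
      exact le_trans (le_add_of_nonneg_left h2) (hpoint s hs)
  refine ⟨hcT, hwL, f, hf0, hfL, hfd, ?_⟩
  have hw2i := hwL.norm.integrable_sq
  have hf2i := hfL.integrable_sq
  rw [← integral_const_mul, ← integral_const_mul, ← integral_const_mul,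
    ← integral_add (hw2i.const_mul _) (hf2i.const_mul _)]
  exact setIntegral_mono_on ((hw2i.const_mul _).add (hf2i.const_mul _)) hδ2
    measurableSet_Ioi fun s hs => hpoint s (le_of_lt hs)

theorem le_add_of_weighted_bounds {q J k a₁ a₂ b₁ b₂ V E F D : ℝ} (hk : 0 ≤ k) (hV : 0 ≤ V)
    (hE : 0 ≤ E) (hF : 0 ≤ F) (hq : q ≤ k * J) (hJ : J ≤ a₁ * (V + E) + a₂ * F)
    (h₁ : k * a₁ ≤ b₁) (h₂ : k * a₂ ≤ b₂) (hD : b₁ * E + b₂ * F ≤ D) : q ≤ b₁ * V + D := by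
  have h3 := mul_le_mul_of_nonneg_left hJ hk
  have h4 := mul_le_mul_of_nonneg_right h₁ (add_nonneg hV hE)
  have h5 := mul_le_mul_of_nonneg_right h₂ hF
  linarith

/-- `L₂` estimate for the performance output of the state along a trajectory. -/
theorem exists_performance_bound (hn : 0 < n) (hN : 0 < N)
    {S : SensorNetwork n Ny N} {K : Constants} (hexc : Excitation S K)
    {Δ₁ : Matrix (Fin N) (Fin r) ℝ} {Δ₂ : S.OutDisturbance r} (hΔ₂ : Δ₂.IsMeasurable)
    {Q : Matrix (Fin p) (Fin n × Fin N) ℝ} {W : Matrix (Fin p) (Fin r) ℝ} (hW : Wᵀ * W = 1)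
    {r₁ : ℝ} (hr₁ : 0 < r₁) {α : ℝ} (hα : 0 < α) {c₂ : ℝ} (hc₂ : 0 < c₂)
    (hc₂Q : (c₂Matrix Q (K.ι₃lo n r₁ α) c₂).PosDef)
    {c₁ γ₁ γ₂ γ : ℝ} (hsdp : SDPFeasible S K Δ₁ Δ₂ Q W r₁ α c₂ c₁ γ₁ γ₂ γ)
    {Γ : Fin n → Matrix (Fin N) (Fin N) ℝ} (hΓ : ∀ i, (Γ i).PosDef)
    (hΓr₁ : ‖blkDiag Γ‖ ≤ r₁)
    (hΓlower : (blkDiag Γ - √γ₂ • (1 : Matrix (Fin n × Fin N) (Fin n × Fin N) ℝ)).PosSemidef)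
    (x₀ : EuclideanSpace ℝ (Fin n × Fin N)) :
    ∃ V : ℝ, 0 ≤ V ∧ ∀ δ x, MemLp δ 2 halfLine → IsTrajectory S α Γ Δ₁ Δ₂ x₀ δ x →
      MemLp x 2 halfLine ∧
        ∫ s, ‖Matrix.toEuclideanLin Q (x s)‖ ^ 2 ∂halfLine
          ≤ V + (γ - 1) * ∫ s, ‖δ s‖ ^ 2 ∂halfLine := by
  have hhalf : halfLine = volume.restrict (Set.Ioi (0 : ℝ)) :=
    Measure.restrict_congr_set Ioi_ae_eq_Ici.symm
  have : Nonempty (Fin n × Fin N) := ⟨(⟨0, hn⟩, ⟨0, hN⟩)⟩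
  have hT := hexc.T_pos
  have hι₃ : 0 < K.ι₃lo n r₁ α := c₂Matrix_pos hc₂ hc₂Q
  have hr₄ : 0 < K.r₄ α := add_pos hexc.r₂_pos (mul_pos hα hexc.r₃_pos)
  have hι₂hi : 0 < K.ι₂hi α := mul_pos hT hr₄
  have hι₂le := hexc.ι₂lo_le_ι₂hi hn hN hα.le
  have hι₂nonneg := Constants.ι₂lo_nonneg (n := n) (K := K) hα.le hexc.lam_pos.le
  -- By the unified formula, `ι₂ = 0` would force `ι₃ = 0`.
  have hι₂ : 0 < K.ι₂lo n α := by
    refine hι₂nonneg.lt_of_ne fun h => hι₃.ne' ?_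
    rw [Constants.ι₃lo_eq hι₂nonneg hι₂le hι₂hi, ← h, zero_div, zero_pow two_ne_zero]
  have hφ : 0 ≤ K.φ₁ r₁ α := by unfold Constants.φ₁; positivity
  have hι := Constants.ι₃lo_mul_le (r₁ := r₁) hι₂ hι₂le (Real.sqrt_nonneg (K.φ₁ r₁ α))
    (Real.sq_sqrt hφ).symm
  have hdiv : K.ι₂hi α / K.T = √(K.r₄ α) ^ 2 := by
    rw [Real.sq_sqrt hr₄.le, Constants.ι₂hi, mul_div_cancel_left₀ _ hT.ne']
  have hV0 : 0 ≤ inner ℝ (Matrix.toEuclideanLin (blkDiag Γ)⁻¹ x₀) x₀ :=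
    nonneg_of_mul_nonneg_right
      ((sq_nonneg _).trans (norm_sq_le_mul_inner_inv (blkDiag_posDef hΓ) hr₁ hΓr₁ x₀)) hr₁
  -- The bias must be fixed before `δ`, whereas `0 < c₁` is only extracted once a `δ` is given; the
  -- maximum with `0` bridges this.
  refine ⟨max c₁ 0 * inner ℝ (Matrix.toEuclideanLin (blkDiag Γ)⁻¹ x₀) x₀,
    mul_nonneg (le_max_right _ _) hV0, fun δ x hδ hx => ?_⟩
  rw [hhalf] at hδ ⊢
  obtain ⟨hcT, hwL, f, hf0, hfL, hfd, hdist⟩ := hsdp.disturbance_energy_le hn hN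
    (hexc.Ny_pos hN) hT hΔ₂ hW hr₄.le hι₃ hc₂ hδ
  have hc₁ : 0 < c₁ := lt_of_lt_of_le (by positivity) hcT
  obtain ⟨hxc, hxi, hJ⟩ := hx.integral_norm_sq_le hn hexc hr₁ hα hι₂ (blkDiag_posDef hΓ) hΓr₁
    hΓlower ((le_norm_of_sub_posSemidef hΓlower).trans hΓr₁) hwL hf0 hfL hfd
  obtain ⟨hconst₁, hconst₂⟩ := gain_constants_le hT hι₂ hι₂le hι₃ (Real.sqrt_nonneg _) hι hc₂ hcT
  rw [hdiv] at hconst₂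
  have hxm : AEStronglyMeasurable x (volume.restrict (Set.Ioi 0)) :=
    (hxc.mono Set.Ioi_subset_Ici_self).aestronglyMeasurable measurableSet_Ioi
  refine ⟨(memLp_two_iff_integrable_sq_norm hxm).2 hxi, ?_⟩
  have hQ : ∫ s in Set.Ioi 0, ‖Matrix.toEuclideanLin Q (x s)‖ ^ 2
      ≤ c₂ * K.ι₃lo n r₁ α / 2 * ∫ s in Set.Ioi 0, ‖x s‖ ^ 2 := by
    rw [← integral_const_mul]
    refine integral_mono_of_nonneg (Filter.Eventually.of_forall fun s => sq_nonneg _)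
      (hxi.const_mul _) (Filter.Eventually.of_forall fun s => ?_)
    have h := c₂Matrix_bounds hc₂Q (x s).ofLp
    rw [← norm_toLp_sq_eq_dotProduct (x s).ofLp] at h
    exact (norm_toEuclideanLin_sq Q (x s)).trans_le h
  have hE0 : 0 ≤ ∫ s in Set.Ioi 0, ‖Matrix.toEuclideanLin (S.extendRows (Δ₂ s)) (δ s)‖ ^ 2 :=
    integral_nonneg fun s => sq_nonneg _
  have hF0 : 0 ≤ ∫ s in Set.Ioi 0, f s ^ 2 := integral_nonneg fun s => sq_nonneg _
  rw [max_eq_left hc₁.le]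
  exact le_add_of_weighted_bounds (by positivity) hV0 hE0 hF0 hQ hJ hconst₁ hconst₂ hdist

theorem eLpNorm_two_eq_ofReal_sqrt {E : Type*} [NormedAddCommGroup E] {μ : Measure ℝ} {u : ℝ → E}
    (hu : MemLp u 2 μ) : eLpNorm u 2 μ = ENNReal.ofReal √(∫ s, ‖u s‖ ^ 2 ∂μ) := by
  rw [hu.eLpNorm_eq_integral_rpow_norm two_ne_zero ENNReal.ofNat_ne_top, Real.sqrt_eq_rpow]
  simp

end CIEstimation

open CIEstimation in
theorem corollary3 {n Ny N r p : ℕ} (hn : 0 < n) (hN : 0 < N)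
    -- network, with the excitation assumption
    (S : SensorNetwork n Ny N) (K : Constants) (hexc : Excitation S K)
    -- disturbance matrices and performance output
    (Δ₁ : Matrix (Fin N) (Fin r) ℝ) (Δ₂ : S.OutDisturbance r) (hΔ₂ : Δ₂.IsMeasurable)
    (Q : Matrix (Fin p) (Fin n × Fin N) ℝ) (W : Matrix (Fin p) (Fin r) ℝ)
    (hW : W.transpose * W = 1) (hQW : Q.transpose * W = 0)
    -- norm bound for the gain, choice of the consensus gain and of `c₂`
    (r₁ : ℝ) (hr₁ : 0 < r₁)
    (α : ℝ) (hα : 0 < α)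
    (hαmax : IsMaxOn (fun a => K.ι₃lo n r₁ a / K.ι₃hi n r₁ a) (Set.Ioi 0) α)
    (c₂ : ℝ) (hc₂ : 0 < c₂) (hc₂Q : (c₂Matrix Q (K.ι₃lo n r₁ α) c₂).PosDef)
    -- a feasible point of the semidefinite program
    (c₁ γ₁ γ₂ γ : ℝ) (hsdp : SDPFeasible S K Δ₁ Δ₂ Q W r₁ α c₂ c₁ γ₁ γ₂ γ)
    -- choice of the gain matrices
    (Γ : Fin n → Matrix (Fin N) (Fin N) ℝ) (hΓ : ∀ i, (Γ i).PosDef)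
    (hΓr₁ : ‖blkDiag Γ‖ ≤ r₁)
    (hΓupper : (√γ₁ • (1 : Matrix (Fin n × Fin N) (Fin n × Fin N) ℝ) - blkDiag Γ).PosSemidef)
    (hΓlower : (blkDiag Γ - √γ₂ • (1 : Matrix (Fin n × Fin N) (Fin n × Fin N) ℝ)).PosSemidef) :
    ∀ x₀ : EuclideanSpace ℝ (Fin n × Fin N),
      l2Gain (IORelation S α Γ Δ₁ Δ₂ Q W x₀) ≤ ENNReal.ofReal √γ := by
  intro x₀
  obtain ⟨V, hV, hbound⟩ := exists_performance_bound hn hN hexc hΔ₂ hW hr₁ hα hc₂ hc₂Q hsdp hΓ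
    hΓr₁ hΓlower x₀
  refine iInf₂_le (Real.toNNReal √γ) ⟨Real.toNNReal √V, ?_⟩
  rintro δ z hδ ⟨x, hx, hz⟩
  obtain ⟨hxL, hQx⟩ := hbound δ x hδ hx
  have hzeq : z =ᵐ[halfLine] fun t => Matrix.toEuclideanLin Q (x t) + Matrix.toEuclideanLin W (δ t) :=
    (ae_restrict_iff' measurableSet_Ici).2 (Filter.Eventually.of_forall fun t ht => hz t ht)
  have hQL : MemLp (fun t => Matrix.toEuclideanLin Q (x t)) 2 halfLine :=
    (LinearMap.toContinuousLinearMap (Matrix.toEuclideanLin Q)).comp_memLp' hxL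
  have hWL : MemLp (fun t => Matrix.toEuclideanLin W (δ t)) 2 halfLine :=
    (LinearMap.toContinuousLinearMap (Matrix.toEuclideanLin W)).comp_memLp' hδ
  have hzL : MemLp z 2 halfLine := (memLp_congr_ae hzeq).2 (hQL.add hWL)
  refine ⟨hzL, ?_⟩
  -- Pythagoras: the ranges of `Q` and `W` are orthogonal and `W` is isometric.
  have hnorm : ∀ t, ‖Matrix.toEuclideanLin Q (x t) + Matrix.toEuclideanLin W (δ t)‖ ^ 2
      = ‖Matrix.toEuclideanLin Q (x t)‖ ^ 2 + ‖δ t‖ ^ 2 := by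
    intro t
    have h1 : inner ℝ (Matrix.toEuclideanLin Q (x t)) (Matrix.toEuclideanLin W (δ t)) = 0 := by
      rw [inner_toEuclideanLin_left, Matrix.ofLp_toLpLin, Matrix.toLin'_apply,
        ← dotProduct_transpose_mul_mulVec, hQW, zero_mulVec, dotProduct_zero]
    have h2 : ‖Matrix.toEuclideanLin W (δ t)‖ ^ 2 = ‖δ t‖ ^ 2 := by
      rw [norm_toEuclideanLin_sq, ← dotProduct_transpose_mul_mulVec, hW, one_mulVec,
        ← norm_toLp_sq_eq_dotProduct]
    rw [norm_add_sq_real, h1, h2]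
    ring
  have hzint : ∫ t, ‖z t‖ ^ 2 ∂halfLine ≤ V + γ * ∫ t, ‖δ t‖ ^ 2 ∂halfLine := by
    have h1 : ∫ t, ‖z t‖ ^ 2 ∂halfLine
        = ∫ t, (‖Matrix.toEuclideanLin Q (x t)‖ ^ 2 + ‖δ t‖ ^ 2) ∂halfLine :=
      integral_congr_ae (hzeq.mono fun t ht => by simp only [ht, hnorm])
    rw [h1, integral_add hQL.norm.integrable_sq hδ.norm.integrable_sq]
    linarith
  rw [eLpNorm_two_eq_ofReal_sqrt hzL, eLpNorm_two_eq_ofReal_sqrt hδ]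
  change _ ≤ ENNReal.ofReal √γ * _ + ENNReal.ofReal √V
  rw [← ENNReal.ofReal_mul (Real.sqrt_nonneg _), ← Real.sqrt_mul hsdp.γ_pos.le,
    ← ENNReal.ofReal_add (Real.sqrt_nonneg _) (Real.sqrt_nonneg _)]
  refine ENNReal.ofReal_le_ofReal ((Real.sqrt_le_sqrt hzint).trans ?_)
  have h0 : 0 ≤ γ * ∫ t, ‖δ t‖ ^ 2 ∂halfLine :=
    mul_nonneg hsdp.γ_pos.le (integral_nonneg fun _ => sq_nonneg _)
  -- Subadditivity of the square root separates the gain `√γ` from the bias `√V`.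
  refine Real.sqrt_le_iff.2 ⟨by positivity, ?_⟩
  rw [add_sq, Real.sq_sqrt h0, Real.sq_sqrt hV]
  have h1 := mul_nonneg (Real.sqrt_nonneg (γ * ∫ t, ‖δ t‖ ^ 2 ∂halfLine)) (Real.sqrt_nonneg V)
  linarith
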